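/- **Setting.** Let $(X,f)$ be a hyperbolic system with contraction rate $\lambda\in(0,1)$, i.e. one of: (a) a transitive Anosov diffeomorphism of a compact connected Riemannian manifold; (b) the restriction of a diffeomorphism of a Riemannian manifold to a compact invariant locally maximal hyperbolic set on which it is topologically mixing; in (a), (b) one has $\|Df\,v\|<\lambda$ for unit $v\in E^s$ and $\|Df\,v\|>\lambda^{-1}$ for unit $v\in E^u$, where $E^s\oplus E^u$ is the continuous $Df$-invariant hyperbolic splitting, and $d_X$ is the Riemannian distance; (c) a mixing subshift of finite type with the metric $d_X(x,y)=\lambda^{\min\{|i|\,:\,x_i\ne y_i\}}$ for $x\neq y$. The stable set $W^s(x)$ consists of all $y\in X$ for which there are $C$ and $\tau\in(0,1)$ with $d_X(f^nx,f^ny)\le C\tau^n$ for all $n\ge 0$. The local stable set $W^s_{loc}(x)$ consists of all $y\in X$ with $d_X(f^nx,f^ny)\le\lambda^n d_X(x,y)$ for all $n\ge 0$. Let $\mathcal M$ be a compact connected smooth manifold. Fix any finite family of smooth charts $\varphi_i$ of $\mathcal M$ with compact subsets $K_i$ of their domains whose interiors cover $\mathcal M$, and any smooth embedding $u:\mathcal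 M\to\mathbb R^m$. For $k\in\mathbb N$, $k\ge1$, and $0<\alpha<1$, and a $C^k$ map $G:\mathcal M\to\mathbb R^m$ put $$\|G\|_{C^{k+\alpha}}=\max_{i}\max_{0\le j\le k}\sup_{t\in K_i}\|D^j(G\circ\varphi_i^{-1})(\varphi_i(t))\|+\max_i\sup_{t\ne t'\in K_i}\frac{\|D^k(G\circ\varphi_i^{-1})(\varphi_i(t))-D^k(G\circ\varphi_i^{-1})(\varphi_i(t'))\|}{|\varphi_i(t)-\varphi_i(t')|^{\alpha}}.$$ For $C^k$ diffeomorphisms $g,h$ of $\mathcal M$ let $|g|_{C^{k+\alpha}}=\|u\circ g\|_{C^{k+\alpha}}+\|u\circ g^{-1}\|_{C^{k+\alpha}}$ and $d_{C^{k+\alpha}}(g,h)=\|u\circ g-u\circ h\|_{C^{k+\alpha}}+\|u\circ g^{-1}-u\circ h^{-1}\|_{C^{k+\alpha}}$, and let $\mathrm{Diff}^{k+\alpha}(\mathcal M)$ be the set of those $g$ with $|g|_{C^{k+\alpha}}<\infty$, with the distance $d_{C^{k+\alpha}}$. For $A:X\to\mathrm{Diff}^{q}(\mathcal M)$, $x\mapsto\mathcal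 A_x$, write $\mathcal A^n_x=\mathcal A_{f^{n-1}x}\circ\dots\circ\mathcal A_x$, $\mathcal A^0_x=\mathrm{Id}$. **Proposition 3.3.** Let $q=k+\gamma$ and $r=k+\alpha$ with $k\in\mathbb N$, $k\ge 1$, $0<\alpha<\gamma<1$, let $0<\beta\le1$, and let $\rho=q-r$. Let $A:X\to\mathrm{Diff}^q(\mathcal M)$ be $\beta$-Hölder, i.e. for some $c>0$, $d_{C^q}(\mathcal A_x,\mathcal A_y)\le c\,d_X(x,y)^\beta$ for all $x,y\in X$. Suppose that for each $\epsilon>0$ there is $K_\epsilon$ such that $|\mathcal A^n_x|_{C^q}\le K_\epsilon e^{\epsilon n}$ for all $x\in X$ and all integers $n\ge 0$. Then for all $x\in X$ and $y\in W^s(x)$ the limit $$H^s_{x,y}=\lim_{n\to\infty}(\mathcal A^n_y)^{-1}\circ\mathcal A^n_x$$ exists in $\mathrm{Diff}^r(\mathcal M)$, and - (H1) $H^s_{x,x}=\mathrm{Id}$, $H^s_{y,z}\circ H^s_{x,y}=H^s_{x,z}$ for all $y,z\in W^s(x)$, and $(H^s_{x,y})^{-1}=H^s_{y,x}$ for all $y\in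 W^s(x)$; - (H2) $H^s_{x,y}=(\mathcal A^n_y)^{-1}\circ H^s_{f^nx,f^ny}\circ\mathcal A^n_x$ for all $y\in W^s(x)$ and all $n\ge 0$; - (H3) there is a constant $c$ such that for all $x\in X$ and $y\in W^s_{loc}(x)$, $d_{C^r}(H^s_{x,y},\mathrm{Id})\le c\,d_X(x,y)^{\beta\rho}$ and moreover $d_{C^r}((\mathcal A^n_y)^{-1}\circ\mathcal A^n_x,\mathrm{Id})\le c\,d_X(x,y)^{\beta\rho}$ for all $n\ge 0$. -/

import Mathlib

open Set Filter Topology Manifold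
open scoped ContDiff ENNReal

noncomputable section

namespace DiffCocycle

/-! ### Hyperbolic systems -/

section Hyperbolic

universe u

open scoped Bundle

/-- `Es`, `Eu` is a hyperbolic splitting for the differential of `F` over the set `Λ`, with rate
`lam`, with respect to the given Riemannian metric: the two fields of subspaces are complementary,
invariant, continuous, and `‖DF v‖ < lam` for unit `v` in `Es`, `‖DF v‖ > lam⁻¹` for unit `v`
in `Eu`. For complementary fields of subspaces over a closed set `Λ`, continuity of both fields is
the same as closedness of both of them in the tangent bundle. -/
structure IsHyperbolicSplitting {d : ℕ} {N : Type u} [MetricSpace N]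
    [ChartedSpace (EuclideanSpace ℝ (Fin d)) N] [IsManifold (𝓡 d) ∞ N]
    [Bundle.RiemannianBundle (fun p : N => TangentSpace (𝓡 d) p)]
    (F : N → N) (Λ : Set N) (lam : ℝ)
    (Es Eu : ∀ p : N, Submodule ℝ (TangentSpace (𝓡 d) p)) : Prop where
  isCompl : ∀ p ∈ Λ, IsCompl (Es p) (Eu p)
  map_stable : ∀ p ∈ Λ, (Es p).map (mfderiv (𝓡 d) (𝓡 d) F p).toLinearMap = Es (F p)
  map_unstable : ∀ p ∈ Λ, (Eu p).map (mfderiv (𝓡 d) (𝓡 d) F p).toLinearMap = Eu (F p)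
  continuous_stable :
    IsClosed {v : TangentBundle (𝓡 d) N | v.proj ∈ Λ ∧ v.snd ∈ Es v.proj}
  continuous_unstable :
    IsClosed {v : TangentBundle (𝓡 d) N | v.proj ∈ Λ ∧ v.snd ∈ Eu v.proj}
  contracts : ∀ p ∈ Λ, ∀ v ∈ Es p, v ≠ 0 → ‖mfderiv (𝓡 d) (𝓡 d) F p v‖ < lam * ‖v‖
  expands : ∀ p ∈ Λ, ∀ v ∈ Eu p, v ≠ 0 → lam⁻¹ * ‖v‖ < ‖mfderiv (𝓡 d) (𝓡 d) F p v‖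

/-- Some point has a dense full orbit. -/
def IsTransitive {X : Type u} [TopologicalSpace X] (f : X ≃ₜ X) : Prop :=
  ∃ x : X, Dense (range fun n : ℤ => (f ^ n) x)

/-- Topological mixing. -/
def IsTopologicallyMixing {X : Type u} [TopologicalSpace X] (f : X ≃ₜ X) : Prop :=
  ∀ U V : Set X, IsOpen U → IsOpen V → U.Nonempty → V.Nonempty →
    ∃ n₀ : ℕ, ∀ n ≥ n₀, ((f^[n] '' U) ∩ V).Nonempty

/-- `(X, f)` is (isometrically conjugate to) a transitive Anosov diffeomorphism `F` of a compact
connected Riemannian manifold `N`, with hyperbolicity rate `lam`. -/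
def IsTransitiveAnosov {X : Type u} [MetricSpace X] (f : X ≃ₜ X) (lam : ℝ) : Prop :=
  ∃ (d : ℕ) (N : Type u) (_ : MetricSpace N) (_ : CompactSpace N) (_ : ConnectedSpace N)
    (_ : ChartedSpace (EuclideanSpace ℝ (Fin d)) N) (_ : IsManifold (𝓡 d) ∞ N)
    (_ : Bundle.RiemannianBundle (fun p : N => TangentSpace (𝓡 d) p))
    (_ : IsContMDiffRiemannianBundle (𝓡 d) ∞ (EuclideanSpace ℝ (Fin d))
      (fun p : N => TangentSpace (𝓡 d) p))
    (_ : IsRiemannianManifold (𝓡 d) N)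
    (F : N ≃ₘ^1⟮𝓡 d, 𝓡 d⟯ N)
    (Es Eu : ∀ p : N, Submodule ℝ (TangentSpace (𝓡 d) p))
    (e : X ≃ᵢ N),
    IsHyperbolicSplitting F univ lam Es Eu ∧
    (∀ x, e (f x) = F (e x)) ∧ IsTransitive f

/-- `(X, f)` is (isometrically conjugate to) the restriction of a diffeomorphism `F` of a
Riemannian manifold `N` to a compact invariant locally maximal hyperbolic set `Λ`, on which it is
topologically mixing; `Λ` carries the distance of `N`. -/
def IsMixingLocallyMaximalHyperbolic {X : Type u} [MetricSpace X] (f : X ≃ₜ X) (lam : ℝ) : Prop :=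
  ∃ (d : ℕ) (N : Type u) (_ : MetricSpace N)
    (_ : ChartedSpace (EuclideanSpace ℝ (Fin d)) N) (_ : IsManifold (𝓡 d) ∞ N)
    (_ : Bundle.RiemannianBundle (fun p : N => TangentSpace (𝓡 d) p))
    (_ : IsContMDiffRiemannianBundle (𝓡 d) ∞ (EuclideanSpace ℝ (Fin d))
      (fun p : N => TangentSpace (𝓡 d) p))
    (_ : IsRiemannianManifold (𝓡 d) N)
    (F : N ≃ₘ^1⟮𝓡 d, 𝓡 d⟯ N) (Λ U : Set N)
    (Es Eu : ∀ p : N, Submodule ℝ (TangentSpace (𝓡 d) p))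
    (e : X ≃ᵢ Λ),
    IsCompact Λ ∧ F '' Λ = Λ ∧ IsHyperbolicSplitting F Λ lam Es Eu ∧
    IsOpen U ∧ Λ ⊆ U ∧ Λ = (⋂ n : ℤ, {p : N | (F.toHomeomorph ^ n) p ∈ U}) ∧
    (∀ x, (e (f x) : N) = F (e x)) ∧ IsTopologicallyMixing f

/-- `(X, f)` is (isometrically conjugate to) a mixing subshift of finite type: the two-sided
sequences over `{0, …, m - 1}` whose transitions are allowed by a primitive `0`-`1` matrix, with
the left shift and the metric `d(x, y) = lam ^ min {|i| : x i ≠ y i}`. -/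
def IsMixingSubshift {X : Type u} [MetricSpace X] (f : X ≃ₜ X) (lam : ℝ) : Prop :=
  ∃ (m : ℕ) (T : Matrix (Fin m) (Fin m) ℕ)
    (e : X ≃ {s : ℤ → Fin m // ∀ n : ℤ, T (s n) (s (n + 1)) = 1}),
    (∀ i j, T i j = 0 ∨ T i j = 1) ∧
    (∃ n : ℕ, 0 < n ∧ ∀ i j, 0 < (T ^ n) i j) ∧
    (∀ (x : X) (n : ℤ), (e (f x)).1 n = (e x).1 (n + 1)) ∧
    (∀ x y : X, x ≠ y →
      dist x y = lam ^ sInf {j : ℕ | ∃ i : ℤ, i.natAbs = j ∧ (e x).1 i ≠ (e y).1 i})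

/-- Hyperbolic systems with contraction rate `lam`. -/
def IsHyperbolicSystem {X : Type u} [MetricSpace X] (f : X ≃ₜ X) (lam : ℝ) : Prop :=
  0 < lam ∧ lam < 1 ∧
    (IsTransitiveAnosov f lam ∨ IsMixingLocallyMaximalHyperbolic f lam ∨ IsMixingSubshift f lam)

/-- The (global) stable set `W^s(x)`: the points whose forward orbit is exponentially asymptotic
to the forward orbit of `x`. For a hyperbolic system it is the stable leaf of `x`. -/
def stableSet {X : Type u} [MetricSpace X] (f : X ≃ₜ X) (x : X) : Set X :=
  {y | ∃ C τ : ℝ, 0 < τ ∧ τ < 1 ∧ ∀ n : ℕ, dist (f^[n] x) (f^[n] y) ≤ C * τ ^ n}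

/-- The local stable set `W^s_loc(x)`: the points whose forward orbit is contracted towards the
forward orbit of `x` with rate `lam`, from time zero on. It contains every small ball around `x`
in the stable leaf on which this contraction holds; for the subshift it equals
`{y | y i = x i for all i ≥ 0}`. -/
def localStableSet {X : Type u} [MetricSpace X] (f : X ≃ₜ X) (lam : ℝ) (x : X) : Set X :=
  {y | ∀ n : ℕ, dist (f^[n] x) (f^[n] y) ≤ lam ^ n * dist x y}

end Hyperbolic

/-! ### The `C^r` size and distance on diffeomorphisms -/

section Diffeo

variable {d : ℕ} {M : Type*} [TopologicalSpace M] [ChartedSpace (EuclideanSpace ℝ (Fin d)) M]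

/-- Auxiliary choices that turn the `C^r` topology into norms: finitely many smooth charts with
compact pieces of their domains whose interiors cover the manifold, and a smooth embedding
`emb` into a Euclidean space (through which differences of maps into `M` are taken). -/
structure Background (d : ℕ) (M : Type*) [TopologicalSpace M]
    [ChartedSpace (EuclideanSpace ℝ (Fin d)) M] where
  num : ℕ
  chart : Fin num → OpenPartialHomeomorph M (EuclideanSpace ℝ (Fin d))
  core : Fin num → Set M
  dim : ℕ
  emb : M → EuclideanSpace ℝ (Fin dim)
  chart_mem : ∀ i, chart i ∈ IsManifold.maximalAtlas (𝓡 d) ∞ M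
  core_compact : ∀ i, IsCompact (core i)
  core_subset : ∀ i, core i ⊆ (chart i).source
  core_cover : (⋃ i, interior (core i)) = univ
  emb_smooth : ContMDiff (𝓡 d) (𝓡 dim) ∞ emb
  emb_injective : Function.Injective emb
  emb_immersion : ∀ t : M, Function.Injective (mfderiv (𝓡 d) (𝓡 dim) emb t)

/-- The derivative of order `j` at the point `t` of `G : M → ℝ^m`, read in the chart `φ`. -/
def chartDeriv {m : ℕ} (φ : OpenPartialHomeomorph M (EuclideanSpace ℝ (Fin d))) (j : ℕ)
    (G : M → EuclideanSpace ℝ (Fin m)) (t : M) :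
    ContinuousMultilinearMap ℝ (fun _ : Fin j => EuclideanSpace ℝ (Fin d))
      (EuclideanSpace ℝ (Fin m)) :=
  iteratedFDeriv ℝ j (G ∘ φ.symm) (φ t)

/-- The `C^{k+α}` norm of a `C^k` map `G : M → ℝ^m`, with values in `[0, ∞]`: the largest of the
sup-norms of the derivatives of orders `0, …, k` plus the `α`-Hölder seminorm of the derivative of
order `k`. -/
def holderNorm (B : Background d M) (k : ℕ) (α : ℝ) {m : ℕ}
    (G : M → EuclideanSpace ℝ (Fin m)) : ℝ≥0∞ :=
  (⨆ i : Fin B.num, ⨆ j ≤ k, ⨆ t ∈ B.core i,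
    ENNReal.ofReal ‖chartDeriv (B.chart i) j G t‖) +
  ⨆ i : Fin B.num, ⨆ t ∈ B.core i, ⨆ t' ∈ B.core i,
    ENNReal.ofReal ‖chartDeriv (B.chart i) k G t - chartDeriv (B.chart i) k G t'‖ /
      (edist (B.chart i t) (B.chart i t')) ^ α

/-- The size `|g|_{C^{k+α}} = ‖g‖_{C^{k+α}} + ‖g⁻¹‖_{C^{k+α}}` of a `C^k` diffeomorphism. -/
def diffSize (B : Background d M) (k : ℕ) (α : ℝ) (g : M ≃ₘ^k⟮𝓡 d, 𝓡 d⟯ M) : ℝ≥0∞ :=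
  holderNorm B k α (fun t => B.emb (g t)) + holderNorm B k α (fun t => B.emb (g.symm t))

/-- The `C^k` diffeomorphism `g` belongs to `Diff^{k+α}(M)`: the derivatives of order `k` of `g`
and of `g⁻¹` are `α`-Hölder. -/
def IsDiff (B : Background d M) (k : ℕ) (α : ℝ) (g : M ≃ₘ^k⟮𝓡 d, 𝓡 d⟯ M) : Prop :=
  diffSize B k α g < ⊤

/-- The distance `d_{C^{k+α}}(g, h) = ‖g - h‖_{C^{k+α}} + ‖g⁻¹ - h⁻¹‖_{C^{k+α}}`. -/
def diffDist (B : Background d M) (k : ℕ) (α : ℝ) (g h : M ≃ₘ^k⟮𝓡 d, 𝓡 d⟯ M) : ℝ≥0∞ :=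
  holderNorm B k α (fun t => B.emb (g t) - B.emb (h t)) +
    holderNorm B k α (fun t => B.emb (g.symm t) - B.emb (h.symm t))

/-- The iterates `A^n_x = A(f^{n-1} x) ∘ ⋯ ∘ A(x)` of the cocycle over `f` generated by `A`. -/
def cocycle {X : Type*} {k : ℕ} (f : X → X) (A : X → M ≃ₘ^k⟮𝓡 d, 𝓡 d⟯ M) :
    ℕ → X → M ≃ₘ^k⟮𝓡 d, 𝓡 d⟯ M
  | 0, _ => Diffeomorph.refl (𝓡 d) M k
  | n + 1, x => (cocycle f A n x).trans (A (f^[n] x))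

/-- The map `(A^n_y)⁻¹ ∘ A^n_x`. -/
def preHolonomy {X : Type*} {k : ℕ} (f : X → X) (A : X → M ≃ₘ^k⟮𝓡 d, 𝓡 d⟯ M) (n : ℕ)
    (x y : X) : M ≃ₘ^k⟮𝓡 d, 𝓡 d⟯ M :=
  (cocycle f A n x).trans (cocycle f A n y).symm

end Diffeo

end DiffCocycle

end

/-! Write `H_n = (A^n_y)⁻¹ ∘ A^n_x`. Both `H_{n+1}` and `H_n` have the form `h ∘ a ∘ g` with `h =
(A^{n+1}_y)⁻¹` and `g = A^n_x`; the middle map is `A_{f^n x}` for the former and `A_{f^n y}` for the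
latter. On a stable pair these two middle maps are `O(τ^{βn})` apart in `C^{k+γ}`, while `h` and `g`
have size at most `K e^{ε(n+1)}` with `ε` as small as desired.

The analytic core is `Background.exists_holderBound_comp_comp_sub`: if all maps have size at most
`R`, replacing `a` by `b` changes `h ∘ a ∘ g` in `C^{k+α}` by at most `C R^N ‖a - b‖^{γ-α}`, the
right-hand norm being that of `C^{k+γ}`. Right composition is linear and bounded
(`Background.exists_holderBound_comp`). Left composition is only Hölder, with a loss of `γ - α`
derivatives (`Background.exists_holderBound_comp_sub`): the difference is `O(D^γ)` in sup norm and
bounded in `C^{k+γ}`, and one interpolates. For small `ε` the factor `R^N` loses to `τ^{βρn}`, where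
`ρ = γ - α`, so the increments decay geometrically (`exists_holderBound_preHolonomy_succ_sub`).

Completeness of the Hölder space gives limits of both `H_n` and `H_n⁻¹`; they stay in the embedded
manifold and are inverse to each other (`exists_holonomy`). The algebraic identities pass to the
limit from those for `H_n`, and summing the geometric series from `n = 0`, where `H_0 = Id`, gives
the distance to the identity.

To differentiate compositions without charts in the target, a map on `M` is extended locally to the
ambient Euclidean space through a smooth retraction. A composition read in a source chart is then
one of maps between Euclidean spaces, and Faà di Bruno's formula applies. -/

noncomputable section

/-! ### Compositions, mean values and limits of `C^k` maps between normed spaces -/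

section NormedSpace

variable {E F G : Type*} [NormedAddCommGroup E] [NormedSpace ℝ E] [NormedAddCommGroup F]
  [NormedSpace ℝ F] [NormedAddCommGroup G] [NormedSpace ℝ G]

/-- A combinatorial constant in the estimates for derivatives of order at most `k` of a
composition. -/
def compConst (k : ℕ) : ℝ :=
  1 + ∑ n ∈ Finset.range (k + 1), (Fintype.card (OrderedFinpartition n) : ℝ) * (n + 1)

theorem one_le_compConst (k : ℕ) : 1 ≤ compConst k := by
  unfold compConst
  have : 0 ≤ ∑ n ∈ Finset.range (k + 1), (Fintype.card (OrderedFinpartition n) : ℝ) * (n + 1) :=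
    Finset.sum_nonneg fun _ _ => by positivity
  linarith

theorem card_mul_le_compConst {k n : ℕ} (h : n ≤ k) :
    (Fintype.card (OrderedFinpartition n) : ℝ) * (n + 1) ≤ compConst k := by
  unfold compConst
  have := Finset.single_le_sum
    (f := fun n : ℕ => (Fintype.card (OrderedFinpartition n) : ℝ) * (n + 1))
    (fun _ _ => by positivity) (Finset.mem_range.2 (Nat.lt_succ_of_le h))
  linarith

theorem norm_taylorComp_le {k n : ℕ} (hn : n ≤ k) {q : FormalMultilinearSeries ℝ F G}
    {p : FormalMultilinearSeries ℝ E F} {a R : ℝ} (hR : 1 ≤ R) (hq : ∀ j ≤ k, ‖q j‖ ≤ a)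
    (hp : ∀ j ≤ k, ‖p j‖ ≤ R) :
    ‖q.taylorComp p n‖ ≤ compConst k * (a * R ^ k) := by
  have ha : 0 ≤ a := (norm_nonneg _).trans (hq 0 (Nat.zero_le _))
  have key : ∀ c : OrderedFinpartition n, ‖q.compAlongOrderedFinpartition p c‖ ≤ a * R ^ k := by
    intro c
    refine (c.norm_compAlongOrderedFinpartition_le _ _).trans ?_
    have h1 : ∏ i, ‖p (c.partSize i)‖ ≤ R ^ c.length := by
      calc ∏ i, ‖p (c.partSize i)‖ ≤ ∏ _i : Fin c.length, R :=
            Finset.prod_le_prod (fun _ _ => norm_nonneg _)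
              fun i _ => hp _ ((c.partSize_le i).trans hn)
        _ = R ^ c.length := by simp
    have h2 : R ^ c.length ≤ R ^ k := pow_le_pow_right₀ hR (c.length_le.trans hn)
    exact mul_le_mul (hq _ (c.length_le.trans hn)) (h1.trans h2)
      (Finset.prod_nonneg fun _ _ => norm_nonneg _) ha
  calc ‖q.taylorComp p n‖ ≤ ∑ c : OrderedFinpartition n, ‖q.compAlongOrderedFinpartition p c‖ :=
        norm_sum_le _ _
    _ ≤ ∑ _c : OrderedFinpartition n, a * R ^ k := Finset.sum_le_sum fun c _ => key c
    _ = Fintype.card (OrderedFinpartition n) * (a * R ^ k) := by simp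
    _ ≤ compConst k * (a * R ^ k) := by
        gcongr
        refine le_trans ?_ (card_mul_le_compConst hn)
        exact le_mul_of_one_le_right (by positivity) (by linarith [Nat.cast_nonneg (α := ℝ) n])

/-- Each term of Faà di Bruno's formula is linear in the outer coefficient and in at most `n` inner
ones. Exchanging these one at a time costs at most `n + 1` differences, which explains the weight `n
+ 1` in `compConst`. -/
theorem norm_taylorComp_sub_le {k n : ℕ} (hn : n ≤ k) {q₁ q₂ : FormalMultilinearSeries ℝ F G}
    {p₁ p₂ : FormalMultilinearSeries ℝ E F} {a R e₁ e₂ : ℝ} (hR : 1 ≤ R)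
    (hq : ∀ j ≤ k, ‖q₁ j‖ ≤ a) (hp₁ : ∀ j ≤ k, ‖p₁ j‖ ≤ R) (hp₂ : ∀ j ≤ k, ‖p₂ j‖ ≤ R)
    (he₁ : ∀ j ≤ k, ‖q₁ j - q₂ j‖ ≤ e₁) (he₂ : ∀ j ≤ k, ‖p₁ j - p₂ j‖ ≤ e₂) :
    ‖q₁.taylorComp p₁ n - q₂.taylorComp p₂ n‖ ≤ compConst k * (R ^ k * (e₁ + a * e₂)) := by
  have ha : 0 ≤ a := (norm_nonneg _).trans (hq 0 (Nat.zero_le _))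
  have h1 : 0 ≤ e₁ := (norm_nonneg _).trans (he₁ 0 (Nat.zero_le _))
  have h2 : 0 ≤ e₂ := (norm_nonneg _).trans (he₂ 0 (Nat.zero_le _))
  have key : ∀ c : OrderedFinpartition n,
      ‖q₁.compAlongOrderedFinpartition p₁ c - q₂.compAlongOrderedFinpartition p₂ c‖ ≤
        (n + 1) * (R ^ k * (e₁ + a * e₂)) := by
    intro c
    have hl : (c.length : ℝ) ≤ n := by exact_mod_cast c.length_le
    refine (c.norm_compAlongOrderedFinpartition_sub_compAlongOrderedFinpartition_le
      _ _ _ _).trans ?_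
    have h3 : ∏ i, ‖p₂ (c.partSize i)‖ ≤ R ^ k := by
      calc ∏ i, ‖p₂ (c.partSize i)‖ ≤ ∏ _i : Fin c.length, R :=
            Finset.prod_le_prod (fun _ _ => norm_nonneg _)
              fun i _ => hp₂ _ ((c.partSize_le i).trans hn)
        _ = R ^ c.length := by simp
        _ ≤ R ^ k := pow_le_pow_right₀ hR (c.length_le.trans hn)
    have h4 : max ‖fun i => p₁ (c.partSize i)‖ ‖fun i => p₂ (c.partSize i)‖ ≤ R := by
      refine max_le ?_ ?_
      · exact (pi_norm_le_iff_of_nonneg (by linarith)).2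
          fun i => hp₁ _ ((c.partSize_le i).trans hn)
      · exact (pi_norm_le_iff_of_nonneg (by linarith)).2
          fun i => hp₂ _ ((c.partSize_le i).trans hn)
    have h5 : max ‖fun i => p₁ (c.partSize i)‖ ‖fun i => p₂ (c.partSize i)‖ ^ (c.length - 1) ≤
        R ^ k :=
      (pow_le_pow_left₀ (le_max_of_le_left (norm_nonneg _)) h4 _).trans
        (pow_le_pow_right₀ hR ((Nat.sub_le _ _).trans (c.length_le.trans hn)))
    have h6 : ‖(fun i => p₁ (c.partSize i)) - fun i => p₂ (c.partSize i)‖ ≤ e₂ :=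
      (pi_norm_le_iff_of_nonneg h2).2 fun i => he₂ _ ((c.partSize_le i).trans hn)
    have h7 := hq _ (c.length_le.trans hn)
    have h8 := he₁ _ (c.length_le.trans hn)
    calc _ ≤ a * n * R ^ k * e₂ + e₁ * R ^ k := by gcongr
      _ ≤ (n + 1) * (R ^ k * (e₁ + a * e₂)) := by
        have : 0 ≤ (n : ℝ) * (R ^ k * e₁) + R ^ k * (a * e₂) := by positivity
        nlinarith
  rw [FormalMultilinearSeries.taylorComp, FormalMultilinearSeries.taylorComp,
    ← Finset.sum_sub_distrib]
  calc _ ≤ ∑ c : OrderedFinpartition n,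
        ‖q₁.compAlongOrderedFinpartition p₁ c - q₂.compAlongOrderedFinpartition p₂ c‖ :=
        norm_sum_le _ _
    _ ≤ ∑ _c : OrderedFinpartition n, (n + 1) * (R ^ k * (e₁ + a * e₂)) :=
        Finset.sum_le_sum fun c _ => key c
    _ = Fintype.card (OrderedFinpartition n) * (n + 1) * (R ^ k * (e₁ + a * e₂)) := by
        simp [mul_assoc]
    _ ≤ compConst k * (R ^ k * (e₁ + a * e₂)) := by
        gcongr
        exact card_mul_le_compConst hn

theorem norm_iteratedFDeriv_comp_le_compConst {k n : ℕ} (hn : n ≤ k) {f : F → G} {g : E → F}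
    {x : E} {a R : ℝ} (hf : ContDiffAt ℝ k f (g x)) (hg : ContDiffAt ℝ k g x) (hR : 1 ≤ R)
    (hfa : ∀ j ≤ k, ‖iteratedFDeriv ℝ j f (g x)‖ ≤ a)
    (hgR : ∀ j ≤ k, ‖iteratedFDeriv ℝ j g x‖ ≤ R) :
    ‖iteratedFDeriv ℝ n (f ∘ g) x‖ ≤ compConst k * (a * R ^ k) := by
  rw [iteratedFDeriv_comp hf hg (by exact_mod_cast hn)]
  exact norm_taylorComp_le hn hR hfa hgR

/-- Both the inner map and the base point may change. The same estimate thus serves Hölder seminorms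
(one map, two points) and sup norms of differences (two maps, one point). -/
theorem norm_iteratedFDeriv_comp_sub_le_compConst {k n : ℕ} (hn : n ≤ k) {f : F → G}
    {g₁ g₂ : E → F} {x₁ x₂ : E} {a R e₁ e₂ : ℝ} (hf₁ : ContDiffAt ℝ k f (g₁ x₁))
    (hf₂ : ContDiffAt ℝ k f (g₂ x₂)) (hg₁ : ContDiffAt ℝ k g₁ x₁) (hg₂ : ContDiffAt ℝ k g₂ x₂)
    (hR : 1 ≤ R) (hfa : ∀ j ≤ k, ‖iteratedFDeriv ℝ j f (g₁ x₁)‖ ≤ a)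
    (hgR₁ : ∀ j ≤ k, ‖iteratedFDeriv ℝ j g₁ x₁‖ ≤ R)
    (hgR₂ : ∀ j ≤ k, ‖iteratedFDeriv ℝ j g₂ x₂‖ ≤ R)
    (he₁ : ∀ j ≤ k, ‖iteratedFDeriv ℝ j f (g₁ x₁) - iteratedFDeriv ℝ j f (g₂ x₂)‖ ≤ e₁)
    (he₂ : ∀ j ≤ k, ‖iteratedFDeriv ℝ j g₁ x₁ - iteratedFDeriv ℝ j g₂ x₂‖ ≤ e₂) :
    ‖iteratedFDeriv ℝ n (f ∘ g₁) x₁ - iteratedFDeriv ℝ n (f ∘ g₂) x₂‖ ≤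
      compConst k * (R ^ k * (e₁ + a * e₂)) := by
  rw [iteratedFDeriv_comp hf₁ hg₁ (by exact_mod_cast hn),
    iteratedFDeriv_comp hf₂ hg₂ (by exact_mod_cast hn)]
  exact norm_taylorComp_sub_le hn hR hfa hgR₁ hgR₂ he₁ he₂

theorem Convex.norm_iteratedFDeriv_sub_le {k j : ℕ} (hj : j < k) {f : E → F} {s : Set E} {R : ℝ}
    (hs : Convex ℝ s) (hf : ∀ x ∈ s, ContDiffAt ℝ k f x)
    (hR : ∀ x ∈ s, ‖iteratedFDeriv ℝ (j + 1) f x‖ ≤ R) {x y : E} (hx : x ∈ s) (hy : y ∈ s) :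
    ‖iteratedFDeriv ℝ j f x - iteratedFDeriv ℝ j f y‖ ≤ R * ‖x - y‖ :=
  hs.norm_image_sub_le_of_norm_fderiv_le (𝕜 := ℝ)
    (fun z hz => (hf z hz).differentiableAt_iteratedFDeriv (by exact_mod_cast hj))
    (fun z hz => by rw [norm_fderiv_iteratedFDeriv]; exact hR z hz) hy hx

/-- The derivatives of each order converge uniformly, and their limits form a Taylor series for `g`,
since differentiation commutes with locally uniform convergence of derivatives. Uniqueness of Taylor
series on an open set identifies these limits with the derivatives of `g`. -/
theorem contDiffOn_of_tendsto_of_iteratedFDeriv_sub_le [CompleteSpace F] {k : ℕ} {s : Set E}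
    (hs : IsOpen s) {f : ℕ → E → F} {g : E → F} {b : ℕ → ℝ} (hb : Tendsto b atTop (𝓝 0))
    (hf : ∀ n, ∀ x ∈ s, ContDiffAt ℝ k (f n) x)
    (hfb : ∀ n m, n ≤ m → ∀ j ≤ k, ∀ x ∈ s,
      ‖iteratedFDeriv ℝ j (f m) x - iteratedFDeriv ℝ j (f n) x‖ ≤ b n)
    (hfg : ∀ x ∈ s, Tendsto (fun n => f n x) atTop (𝓝 (g x))) :
    ContDiffOn ℝ k g s ∧ ∀ j ≤ k, ∀ x ∈ s,
      Tendsto (fun n => iteratedFDeriv ℝ j (f n) x) atTop (𝓝 (iteratedFDeriv ℝ j g x)) := by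
  have hcau : ∀ j ≤ k, ∀ x ∈ s, ∃ l, Tendsto (fun n => iteratedFDeriv ℝ j (f n) x) atTop (𝓝 l) := by
    intro j hj x hx
    refine cauchySeq_tendsto_of_complete (cauchySeq_of_le_tendsto_0' b (fun n m h => ?_) hb)
    rw [dist_comm, dist_eq_norm]
    exact hfb n m h j hj x hx
  choose! p hp using fun x (hx : x ∈ s) j (hj : j ≤ k) => hcau j hj x hx
  have hunif : ∀ j ≤ k, TendstoUniformlyOn (fun n => iteratedFDeriv ℝ j (f n))
      (fun x => p x j) atTop s := by
    intro j hj
    rw [Metric.tendstoUniformlyOn_iff]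
    intro ε hε
    filter_upwards [hb.eventually (gt_mem_nhds hε)] with n hn x hx
    refine lt_of_le_of_lt ?_ hn
    refine le_of_tendsto ((hp x hx j hj).dist tendsto_const_nhds) ?_
    filter_upwards [eventually_ge_atTop n] with m hm
    rw [dist_eq_norm]
    exact hfb n m hm j hj x hx
  have hT : HasFTaylorSeriesUpToOn k g p s := by
    refine ⟨fun x hx => ?_, fun j hj x hx => ?_, fun j hj => ?_⟩
    · have h1 := hfg x hx
      have h2 : Tendsto (fun n => (iteratedFDeriv ℝ 0 (f n) x).curry0) atTop
          (𝓝 (p x 0).curry0) :=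
        ((continuousMultilinearCurryFin0 ℝ E F).continuous.tendsto _).comp
          (hp x hx 0 (Nat.zero_le _))
      exact tendsto_nhds_unique h2 (by simpa using! h1)
    · have hj' : j < k := by exact_mod_cast hj
      refine HasFDerivAt.hasFDerivWithinAt ?_
      have hu : TendstoUniformlyOn (fun n x => (iteratedFDeriv ℝ (j + 1) (f n) x).curryLeft)
          (fun x => (p x (j + 1)).curryLeft) atTop s := by
        have := (continuousMultilinearCurryLeftEquiv ℝ (fun _ : Fin (j + 1) => E)
          F).isometry.uniformContinuous.comp_tendstoUniformlyOn (hunif (j + 1) hj')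
        exact this
      refine hasFDerivAt_of_tendstoUniformlyOn hs hu (fun n y hy => ?_)
        (fun y hy => hp y hy j hj'.le) hx
      have hd := ((hf n y hy).differentiableAt_iteratedFDeriv (m := j)
        (by exact_mod_cast hj')).hasFDerivAt
      rw [fderiv_iteratedFDeriv] at hd
      exact hd
    · have hj' : j ≤ k := by exact_mod_cast hj
      refine (hunif j hj').continuousOn (Frequently.of_forall fun n => ?_)
      intro x hx
      refine ContinuousAt.continuousWithinAt ?_
      exact (hf n x hx).continuousAt_iteratedFDeriv (by exact_mod_cast hj')
  refine ⟨hT.contDiffOn, fun j hj x hx => ?_⟩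
  have := hT.eq_iteratedFDerivWithin_of_uniqueDiffOn (by exact_mod_cast hj : (j : WithTop ℕ∞) ≤ k)
    hs.uniqueDiffOn hx
  rw [← iteratedFDerivWithin_of_isOpen j hs hx, ← this]
  exact hp x hx j hj

end NormedSpace

namespace DiffCocycle

/-! ### Local extensions of maps on the embedded manifold -/

section Background

variable {d : ℕ} {M : Type*} [TopologicalSpace M] [ChartedSpace (EuclideanSpace ℝ (Fin d)) M]

/-- `R` bounds the derivatives of order at most `k` of `G` in the charts, and the `α`-Hölder
seminorm of those of order `k`. -/
structure HolderBound (B : Background d M) (k : ℕ) (α : ℝ) {m : ℕ}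
    (G : M → EuclideanSpace ℝ (Fin m)) (R : ℝ) : Prop where
  norm_le : ∀ i, ∀ j ≤ k, ∀ t ∈ B.core i, ‖chartDeriv (B.chart i) j G t‖ ≤ R
  sub_le : ∀ i, ∀ t ∈ B.core i, ∀ t' ∈ B.core i,
    ‖chartDeriv (B.chart i) k G t - chartDeriv (B.chart i) k G t'‖ ≤
      R * dist (B.chart i t) (B.chart i t') ^ α

/-- On the ball of radius `r` around `w₀`, the map `e` is a left inverse of the embedding read in
the chart `i`; it takes values in a convex part of the core, and its derivatives of order at most
`n` are bounded by `C`. -/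
structure IsLocalRetraction (B : Background d M) (n : ℕ) (w₀ : EuclideanSpace ℝ (Fin B.dim))
    (r C : ℝ) (i : Fin B.num)
    (e : EuclideanSpace ℝ (Fin B.dim) → EuclideanSpace ℝ (Fin d))
    (Ω : Set (EuclideanSpace ℝ (Fin d))) : Prop where
  convex : Convex ℝ Ω
  dist_le : ∀ y ∈ Ω, ∀ y' ∈ Ω, dist y y' ≤ 1
  subset_target : Ω ⊆ (B.chart i).target
  symm_mem : ∀ y ∈ Ω, (B.chart i).symm y ∈ B.core i
  mapsTo : ∀ w ∈ Metric.ball w₀ r, e w ∈ Ω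
  contDiffAt : ∀ w ∈ Metric.ball w₀ r, ContDiffAt ℝ n e w
  norm_le : ∀ w ∈ Metric.ball w₀ r, ∀ j ≤ n, ‖iteratedFDeriv ℝ j e w‖ ≤ C
  left_inv : ∀ t, B.emb t ∈ Metric.ball w₀ r → (B.chart i).symm (e (B.emb t)) = t

variable {B : Background d M}

theorem IsLocalRetraction.mono {n : ℕ} {w₀ w₁ : EuclideanSpace ℝ (Fin B.dim)} {r r' C C' : ℝ}
    {i : Fin B.num} {e : EuclideanSpace ℝ (Fin B.dim) → EuclideanSpace ℝ (Fin d)}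
    {Ω : Set (EuclideanSpace ℝ (Fin d))} (h : IsLocalRetraction B n w₀ r C i e Ω)
    (hr : Metric.ball w₁ r' ⊆ Metric.ball w₀ r) (hC : C ≤ C') :
    IsLocalRetraction B n w₁ r' C' i e Ω where
  convex := h.convex
  dist_le := h.dist_le
  subset_target := h.subset_target
  symm_mem := h.symm_mem
  mapsTo w hw := h.mapsTo w (hr hw)
  contDiffAt w hw := h.contDiffAt w (hr hw)
  norm_le w hw j hj := (h.norm_le w (hr hw) j hj).trans hC
  left_inv t ht := h.left_inv t (hr ht)

theorem Background.exists_mem_interior_core (B : Background d M) (t : M) :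
    ∃ i, t ∈ interior (B.core i) := by
  have h : t ∈ ⋃ i, interior (B.core i) := by simp [B.core_cover]
  simpa using h

theorem Background.exists_mem_core (B : Background d M) (t : M) : ∃ i, t ∈ B.core i :=
  (B.exists_mem_interior_core t).imp fun _ h => interior_subset h

theorem Background.contMDiffAt_symm (B : Background d M) (i : Fin B.num)
    {y : EuclideanSpace ℝ (Fin d)} (hy : y ∈ (B.chart i).target) :
    ContMDiffAt (𝓡 d) (𝓡 d) ∞ (B.chart i).symm y :=
  contMDiffAt_symm_of_mem_maximalAtlas (B.chart_mem i) hy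

theorem Background.contDiffAt_comp_symm (B : Background d M) (i : Fin B.num) {n : WithTop ℕ∞}
    (hn : n ≤ (∞ : WithTop ℕ∞)) {m : ℕ} {G : M → EuclideanSpace ℝ (Fin m)} (hG : ContMDiff (𝓡 d) (𝓡 m) n G)
    {y : EuclideanSpace ℝ (Fin d)} (hy : y ∈ (B.chart i).target) :
    ContDiffAt ℝ n (G ∘ (B.chart i).symm) y :=
  ((hG _).comp y ((B.contMDiffAt_symm i hy).of_le hn)).contDiffAt

theorem natCast_le_infty (k : ℕ) : (k : WithTop ℕ∞) ≤ (∞ : WithTop ℕ∞) := by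
  exact_mod_cast (le_top : (k : ℕ∞) ≤ ⊤)

theorem Background.injective_fderiv_emb_comp_symm (B : Background d M) (i : Fin B.num)
    {y : EuclideanSpace ℝ (Fin d)} (hy : y ∈ (B.chart i).target) :
    Function.Injective (fderiv ℝ (B.emb ∘ (B.chart i).symm) y) := by
  have hφ : (B.chart i).MDifferentiable (𝓡 d) (𝓡 d) :=
    ⟨(contMDiffOn_of_mem_maximalAtlas (B.chart_mem i)).mdifferentiableOn (by simp),
      (contMDiffOn_symm_of_mem_maximalAtlas (B.chart_mem i)).mdifferentiableOn (by simp)⟩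
  have h1 : MDifferentiableAt (𝓡 d) (𝓡 B.dim) B.emb ((B.chart i).symm y) :=
    (B.emb_smooth _).mdifferentiableAt (by simp)
  have h2 : MDifferentiableAt (𝓡 d) (𝓡 d) (B.chart i).symm y :=
    hφ.symm.mdifferentiableAt hy
  rw [← mfderiv_eq_fderiv, mfderiv_comp y h1 h2]
  exact (B.emb_immersion _).comp (hφ.symm.mfderiv_injective hy)

variable [CompactSpace M]

theorem Background.isClosedEmbedding (B : Background d M) : IsClosedEmbedding B.emb :=
  B.emb_smooth.continuous.isClosedEmbedding B.emb_injective

/-- No tubular neighbourhood is needed: a linear left inverse `P` of the derivative of `h = emb ∘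
φ⁻¹` makes `P ∘ h` a local diffeomorphism of `ℝ^d`, and `(P ∘ h)⁻¹ ∘ P` recovers the chart
coordinate from the embedded point. -/
theorem Background.exists_isLocalRetraction_at (B : Background d M) {n : ℕ} (hn : n ≠ 0) (t : M) :
    ∃ r > 0, ∃ C, ∃ i e Ω, IsLocalRetraction B n (B.emb t) r C i e Ω := by
  obtain ⟨i, hi⟩ := B.exists_mem_interior_core t
  set φ := B.chart i with hφ
  have hts : t ∈ φ.source := B.core_subset i (interior_subset hi)
  set a := φ t with ha
  have hat : a ∈ φ.target := φ.map_source hts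
  have hsa : φ.symm a = t := φ.left_inv hts
  set h := B.emb ∘ φ.symm with hh
  have hha : h a = B.emb t := by simp [hh, hsa]
  have hsmooth : ContDiffAt ℝ n h a :=
    (B.contDiffAt_comp_symm i le_rfl B.emb_smooth hat).of_le (natCast_le_infty n)
  have hn1 : (n : WithTop ℕ∞) ≠ 0 := by exact_mod_cast hn
  obtain ⟨P₀, hP₀⟩ := (fderiv ℝ h a).toLinearMap.exists_leftInverse_of_injective
    (LinearMap.ker_eq_bot.2 (B.injective_fderiv_emb_comp_symm i hat))
  set P : EuclideanSpace ℝ (Fin B.dim) →L[ℝ] EuclideanSpace ℝ (Fin d) := P₀.toContinuousLinearMap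
    with hP
  have hPh : ContDiffAt ℝ n (P ∘ h) a := P.contDiff.contDiffAt.comp a hsmooth
  have hPh' : HasFDerivAt (P ∘ h)
      ((ContinuousLinearEquiv.refl ℝ (EuclideanSpace ℝ (Fin d)) :
        EuclideanSpace ℝ (Fin d) ≃L[ℝ] EuclideanSpace ℝ (Fin d)) :
        EuclideanSpace ℝ (Fin d) →L[ℝ] EuclideanSpace ℝ (Fin d)) a := by
    have h1 := P.hasFDerivAt.comp a (hsmooth.differentiableAt hn1).hasFDerivAt
    have h2 : P.comp (fderiv ℝ h a) = ContinuousLinearMap.id ℝ (EuclideanSpace ℝ (Fin d)) :=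
      ContinuousLinearMap.ext fun v => LinearMap.congr_fun hP₀ v
    rw [h2] at h1
    exact h1
  set θ := hPh.toOpenPartialHomeomorph (P ∘ h) hPh' hn1 with hθ
  have hθc : (θ : EuclideanSpace ℝ (Fin d) → EuclideanSpace ℝ (Fin d)) = P ∘ h := rfl
  have haθ : a ∈ θ.source := hPh.mem_toOpenPartialHomeomorph_source hPh' hn1
  have hθs : ContDiffAt ℝ n θ.symm (P (B.emb t)) := by
    have := hPh.to_localInverse hPh' hn1
    rw [Function.comp_apply, hha] at this
    exact this
  have hθa : θ.symm (P (B.emb t)) = a := by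
    rw [← hha]
    exact θ.left_inv haθ
  set e : EuclideanSpace ℝ (Fin B.dim) → EuclideanSpace ℝ (Fin d) := θ.symm ∘ P with he
  have hec : ContDiffAt ℝ n e (B.emb t) := hθs.comp _ P.contDiff.contDiffAt
  have hea : e (B.emb t) = a := hθa
  have hopen : IsOpen (φ.target ∩ φ.symm ⁻¹' interior (B.core i)) :=
    φ.isOpen_inter_preimage_symm isOpen_interior
  obtain ⟨s, hs, hsub⟩ := Metric.isOpen_iff.1 hopen a ⟨hat, by simpa [hsa] using hi⟩
  -- Radius at most `1 / 2` gives diameter at most `1`, so that distances are bounded by their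
  -- `γ`-th powers.
  set s' := min s (1 / 2) with hs'
  have hs'0 : 0 < s' := lt_min hs (by norm_num)
  have hsub' : Metric.ball a s' ⊆ φ.target ∩ φ.symm ⁻¹' interior (B.core i) :=
    (Metric.ball_subset_ball (min_le_left _ _)).trans hsub
  have hb : ∀ j ∈ Iic n, ∀ᶠ w in 𝓝 (B.emb t),
      ‖iteratedFDeriv ℝ j e w‖ ≤ ∑ j ∈ Finset.Iic n, ‖iteratedFDeriv ℝ j e (B.emb t)‖ + 1 := by
    intro j hj
    have hc : ContinuousAt (fun w => ‖iteratedFDeriv ℝ j e w‖) (B.emb t) :=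
      (hec.continuousAt_iteratedFDeriv (by exact_mod_cast hj)).norm
    refine (hc.eventually (gt_mem_nhds ?_)).mono fun w hw => hw.le
    have := Finset.single_le_sum (f := fun j => ‖iteratedFDeriv ℝ j e (B.emb t)‖)
      (fun _ _ => norm_nonneg _) (Finset.mem_Iic.2 hj)
    linarith
  have hb' := (eventually_all_finite (finite_Iic n)).2 hb
  -- Since `emb` is a topological embedding, every `t'` with `emb t'` near `emb t` is near `t`; no
  -- other sheet of the manifold interferes.
  have hl : ∀ᶠ w in 𝓝 (B.emb t), ∀ t', B.emb t' = w → φ.symm (e (B.emb t')) = t' := by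
    have h1 : ∀ᶠ t' in 𝓝 t, t' ∈ φ.source ∧ φ t' ∈ θ.source :=
      Filter.Eventually.and (φ.open_source.mem_nhds hts)
        ((φ.continuousAt hts).eventually (θ.open_source.mem_nhds haθ))
    rw [B.isClosedEmbedding.isEmbedding.nhds_eq_comap, eventually_comap] at h1
    filter_upwards [h1] with w hw t' ht'
    obtain ⟨h2, h3⟩ := hw t' ht'
    have h4 : e (B.emb t') = φ t' := by
      have : P (B.emb t') = θ (φ t') := by simp [hθc, hh, φ.left_inv h2]
      rw [he, Function.comp_apply, this, θ.left_inv h3]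
    rw [h4, φ.left_inv h2]
  have hmem : ∀ᶠ w in 𝓝 (B.emb t), e w ∈ Metric.ball a s' :=
    hec.continuousAt.eventually (by rw [hea]; exact Metric.ball_mem_nhds a hs'0)
  have hdiff : ∀ᶠ w in 𝓝 (B.emb t), ContDiffAt ℝ n e w := hec.eventually (by simp)
  obtain ⟨r, hr, hall⟩ :=
    Metric.eventually_nhds_iff_ball.1 (hb'.and (hl.and (hmem.and hdiff)))
  refine ⟨r, hr, _, i, e, Metric.ball a s', convex_ball a s', fun y hy y' hy' => ?_,
    fun y hy => (hsub' hy).1, fun y hy => interior_subset (hsub' hy).2,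
    fun w hw => (hall w hw).2.2.1, fun w hw => (hall w hw).2.2.2,
    fun w hw j hj => (hall w hw).1 j hj, fun t' ht' => (hall _ ht').2.1 t' rfl⟩
  have h1 := Metric.mem_ball.1 hy
  have h2 := Metric.mem_ball'.1 hy'
  have h3 : s' ≤ 1 / 2 := min_le_right _ _
  linarith [dist_triangle y a y']

/-- Compactness makes the radius and the bound uniform: with half the radius, the retraction found
at one point serves every nearby centre. -/
theorem Background.exists_isLocalRetraction (B : Background d M) {n : ℕ} (hn : n ≠ 0) :
    ∃ δ > 0, δ ≤ 1 / 2 ∧ ∃ C ≥ 1, ∀ t, ∃ i e Ω, IsLocalRetraction B n (B.emb t) δ C i e Ω := by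
  suffices h : ∃ δ > 0, δ ≤ 1 / 2 ∧ ∃ C ≥ (1 : ℝ), ∀ t ∈ (univ : Set M),
      ∃ i e Ω, IsLocalRetraction B n (B.emb t) δ C i e Ω by simpa using h
  refine isCompact_univ.induction_on (p := fun s => ∃ δ > 0, δ ≤ 1 / 2 ∧ ∃ C ≥ (1 : ℝ), ∀ t ∈ s,
      ∃ i e Ω, IsLocalRetraction B n (B.emb t) δ C i e Ω) ?_ ?_ ?_ ?_
  · exact ⟨1 / 2, by norm_num, le_rfl, 1, le_rfl, by simp⟩
  · rintro s s' hss ⟨δ, h1, h2, C, hC, h3⟩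
    exact ⟨δ, h1, h2, C, hC, fun t ht => h3 t (hss ht)⟩
  · rintro s s' ⟨δ, h1, h2, C, hC, h3⟩ ⟨δ', h1', h2', C', hC', h3'⟩
    refine ⟨min δ δ', lt_min h1 h1', (min_le_left _ _).trans h2, max C C',
      hC.trans (le_max_left _ _), fun t ht => ?_⟩
    rcases ht with ht | ht
    · obtain ⟨i, e, Ω, h⟩ := h3 t ht
      exact ⟨i, e, Ω, h.mono (Metric.ball_subset_ball (min_le_left _ _)) (le_max_left _ _)⟩
    · obtain ⟨i, e, Ω, h⟩ := h3' t ht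
      exact ⟨i, e, Ω, h.mono (Metric.ball_subset_ball (min_le_right _ _)) (le_max_right _ _)⟩
  · intro t _
    obtain ⟨r, hr, C, i, e, Ω, h⟩ := B.exists_isLocalRetraction_at hn t
    refine ⟨B.emb ⁻¹' Metric.ball (B.emb t) (r / 2), mem_nhdsWithin_of_mem_nhds
      (B.emb_smooth.continuous.continuousAt (Metric.ball_mem_nhds _ (by linarith))),
      min (r / 2) (1 / 2), lt_min (by linarith) (by norm_num), min_le_right _ _, max C 1,
      le_max_right _ _, fun t' ht' => ⟨i, e, Ω, h.mono ?_ (le_max_left _ _)⟩⟩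
    refine Metric.ball_subset_ball' ?_
    have h1 : dist (B.emb t') (B.emb t) < r / 2 := ht'
    have h2 : min (r / 2) (1 / 2) ≤ r / 2 := min_le_left _ _
    linarith

end Background

end DiffCocycle

/-! ### Power inequalities and Hölder bounds on Euclidean sets. -/

section Auxiliary

theorem norm_iteratedFDeriv_zero_sub {E F : Type*} [NormedAddCommGroup E] [NormedSpace ℝ E]
    [NormedAddCommGroup F] [NormedSpace ℝ F] (f g : E → F) (x y : E) :
    ‖iteratedFDeriv ℝ 0 f x - iteratedFDeriv ℝ 0 g y‖ = ‖f x - g y‖ := by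
  rw [iteratedFDeriv_zero_eq_comp, iteratedFDeriv_zero_eq_comp, Function.comp_apply,
    Function.comp_apply, ← map_sub, LinearIsometryEquiv.norm_map]

theorem Real.mul_rpow_le_mul_rpow {c x γ : ℝ} (hc : 1 ≤ c) (hx : 0 ≤ x) (hγ : γ ≤ 1) :
    (c * x) ^ γ ≤ c * x ^ γ := by
  rw [Real.mul_rpow (by linarith) hx]
  gcongr
  calc c ^ γ ≤ c ^ (1 : ℝ) := Real.rpow_le_rpow_of_exponent_le hc hγ
    _ = c := Real.rpow_one c

theorem Real.self_le_rpow {x γ : ℝ} (hx : 0 ≤ x) (hx1 : x ≤ 1) (hγ : γ ≤ 1) :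
    x ≤ x ^ γ := by
  rcases hx.eq_or_lt with rfl | h
  · exact Real.rpow_nonneg le_rfl _
  · calc x = x ^ (1 : ℝ) := (Real.rpow_one x).symm
      _ ≤ x ^ γ := Real.rpow_le_rpow_of_exponent_ge h hx1 hγ

/-- `R` bounds the `C^{k+γ}` norm of `f` on `s`, the Hölder seminorms of all derivatives of order
at most `k` included. -/
structure IsHolderOn {E F : Type*} [NormedAddCommGroup E] [NormedSpace ℝ E]
    [NormedAddCommGroup F] [NormedSpace ℝ F] (k : ℕ) (γ : ℝ) (f : E → F) (s : Set E) (R : ℝ) :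
    Prop where
  contDiffAt : ∀ x ∈ s, ContDiffAt ℝ k f x
  norm_le : ∀ x ∈ s, ∀ j ≤ k, ‖iteratedFDeriv ℝ j f x‖ ≤ R
  sub_le : ∀ x ∈ s, ∀ y ∈ s, ∀ j ≤ k,
    ‖iteratedFDeriv ℝ j f x - iteratedFDeriv ℝ j f y‖ ≤ R * ‖x - y‖ ^ γ

end Auxiliary

/-! ### Local extension of Hölder maps from the manifold to the ambient space. -/

namespace DiffCocycle

section Background

variable {d : ℕ} {M : Type*} [TopologicalSpace M] [ChartedSpace (EuclideanSpace ℝ (Fin d)) M]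
  {B : Background d M}

theorem HolderBound.nonneg {k m : ℕ} {α R : ℝ} {G : M → EuclideanSpace ℝ (Fin m)}
    (h : HolderBound B k α G R) (t : M) : 0 ≤ R := by
  obtain ⟨i, hi⟩ := B.exists_mem_core t
  exact (norm_nonneg _).trans (h.norm_le i 0 (Nat.zero_le _) t hi)

theorem norm_chartDeriv_zero_sub {m : ℕ} (i : Fin B.num) {t t' : M} (ht : t ∈ B.core i)
    (ht' : t' ∈ B.core i) (G G' : M → EuclideanSpace ℝ (Fin m)) :
    ‖chartDeriv (B.chart i) 0 G t - chartDeriv (B.chart i) 0 G' t'‖ = ‖G t - G' t'‖ := by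
  rw [chartDeriv, chartDeriv, norm_iteratedFDeriv_zero_sub]
  simp [(B.chart i).left_inv (B.core_subset i ht), (B.chart i).left_inv (B.core_subset i ht')]

theorem chartDeriv_sub (i : Fin B.num) {k j m : ℕ} (hj : j ≤ k)
    {G G' : M → EuclideanSpace ℝ (Fin m)} (hG : ContMDiff (𝓡 d) (𝓡 m) k G)
    (hG' : ContMDiff (𝓡 d) (𝓡 m) k G') {t : M} (ht : t ∈ B.core i) :
    chartDeriv (B.chart i) j (fun s => G s - G' s) t =
      chartDeriv (B.chart i) j G t - chartDeriv (B.chart i) j G' t := by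
  have hy := (B.chart i).map_source (B.core_subset i ht)
  have h1 := (B.contDiffAt_comp_symm i (natCast_le_infty k) hG hy).of_le
    (by exact_mod_cast hj : (j : WithTop ℕ∞) ≤ k)
  have h2 := (B.contDiffAt_comp_symm i (natCast_le_infty k) hG' hy).of_le
    (by exact_mod_cast hj : (j : WithTop ℕ∞) ≤ k)
  exact iteratedFDeriv_sub_apply h1 h2

theorem HolderBound.norm_apply_le {k m : ℕ} {α R : ℝ} {G : M → EuclideanSpace ℝ (Fin m)}
    (h : HolderBound B k α G R) (t : M) : ‖G t‖ ≤ R := by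
  obtain ⟨i, hi⟩ := B.exists_mem_core t
  have := h.norm_le i 0 (Nat.zero_le _) t hi
  rw [chartDeriv, norm_iteratedFDeriv_zero] at this
  simpa [(B.chart i).left_inv (B.core_subset i hi)] using this

/-- Precomposition with a local retraction, as an estimate in Hölder spaces. -/
theorem IsLocalRetraction.isHolderOn_comp {k m : ℕ} {γ R δ C : ℝ} (hγ0 : 0 ≤ γ) (hγ1 : γ ≤ 1)
    (hδ : δ ≤ 1 / 2) (hC : 1 ≤ C) {w₀ : EuclideanSpace ℝ (Fin B.dim)} {i : Fin B.num}
    {e : EuclideanSpace ℝ (Fin B.dim) → EuclideanSpace ℝ (Fin d)}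
    {Ω : Set (EuclideanSpace ℝ (Fin d))} (he : IsLocalRetraction B (k + 1) w₀ δ C i e Ω)
    {G : M → EuclideanSpace ℝ (Fin m)} (hG : ContMDiff (𝓡 d) (𝓡 m) k G)
    (hR : HolderBound B k γ G R) :
    IsHolderOn k γ ((G ∘ (B.chart i).symm) ∘ e) (Metric.ball w₀ δ)
      (compConst k * (2 * C ^ (k + 1)) * R) := by
  set φ := B.chart i with hφ
  have hF : ∀ y ∈ Ω, ContDiffAt ℝ k (G ∘ φ.symm) y := fun y hy =>
    B.contDiffAt_comp_symm i (natCast_le_infty k) hG (he.subset_target hy)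
  have heq : ∀ y ∈ Ω, φ (φ.symm y) = y := fun y hy => φ.right_inv (he.subset_target hy)
  have hFR : ∀ y ∈ Ω, ∀ j ≤ k, ‖iteratedFDeriv ℝ j (G ∘ φ.symm) y‖ ≤ R := by
    intro y hy j hj
    have := hR.norm_le i j hj _ (he.symm_mem y hy)
    rwa [chartDeriv, heq y hy] at this
  have hek : ∀ w ∈ Metric.ball w₀ δ, ContDiffAt ℝ k e w := fun w hw =>
    (he.contDiffAt w hw).of_le (by exact_mod_cast Nat.le_succ k)
  have heC : ∀ w ∈ Metric.ball w₀ δ, ∀ j ≤ k, ‖iteratedFDeriv ℝ j e w‖ ≤ C :=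
    fun w hw j hj => he.norm_le w hw j (hj.trans (Nat.le_succ k))
  -- The retraction has one derivative more than `G`, so its derivatives up to order `k` are
  -- Lipschitz.
  have heL : ∀ w ∈ Metric.ball w₀ δ, ∀ w' ∈ Metric.ball w₀ δ, ∀ j ≤ k,
      ‖iteratedFDeriv ℝ j e w - iteratedFDeriv ℝ j e w'‖ ≤ C * ‖w - w'‖ :=
    fun w hw w' hw' j hj => (convex_ball w₀ δ).norm_iteratedFDeriv_sub_le (Nat.lt_succ_of_le hj)
      he.contDiffAt (fun x hx => he.norm_le x hx (j + 1) (by omega)) hw hw'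
  have hw1 : ∀ w ∈ Metric.ball w₀ δ, ∀ w' ∈ Metric.ball w₀ δ, ‖w - w'‖ ≤ ‖w - w'‖ ^ γ := by
    intro w hw w' hw'
    refine Real.self_le_rpow (norm_nonneg _) ?_ hγ1
    rw [← dist_eq_norm]
    have h1 := Metric.mem_ball.1 hw
    have h2 := Metric.mem_ball'.1 hw'
    linarith [dist_triangle w w₀ w']
  have hFL : ∀ y ∈ Ω, ∀ y' ∈ Ω, ∀ j ≤ k,
      ‖iteratedFDeriv ℝ j (G ∘ φ.symm) y - iteratedFDeriv ℝ j (G ∘ φ.symm) y'‖ ≤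
        R * ‖y - y'‖ ^ γ := by
    intro y hy y' hy' j hj
    have hR0 : 0 ≤ R := hR.nonneg (φ.symm y)
    -- Below order `k` the mean value inequality on the convex set `Ω` applies; at order `k` the
    -- Hölder hypothesis on `G` is used.
    rcases hj.lt_or_eq with hj | rfl
    · refine (he.convex.norm_iteratedFDeriv_sub_le hj hF (fun x hx => hFR x hx (j + 1) hj)
        hy hy').trans ?_
      gcongr
      refine Real.self_le_rpow (norm_nonneg _) ?_ hγ1
      rw [← dist_eq_norm]
      exact he.dist_le y hy y' hy'
    · have := hR.sub_le i _ (he.symm_mem y hy) _ (he.symm_mem y' hy')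
      rwa [chartDeriv, chartDeriv, heq y hy, heq y' hy', dist_eq_norm] at this
  have hCk : C ^ k ≤ C ^ (k + 1) := pow_le_pow_right₀ hC (Nat.le_succ k)
  have hCk0 : 0 ≤ C ^ k := by positivity
  have hcc := one_le_compConst k
  refine ⟨fun w hw => (hF _ (he.mapsTo w hw)).comp w (hek w hw), fun w hw j hj => ?_,
    fun w hw w' hw' j hj => ?_⟩
  · have hR0 : 0 ≤ R := hR.nonneg (φ.symm (e w))
    refine (norm_iteratedFDeriv_comp_le_compConst hj (hF _ (he.mapsTo w hw)) (hek w hw) hC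
      (hFR _ (he.mapsTo w hw)) (heC w hw)).trans ?_
    rw [mul_assoc]
    exact mul_le_mul_of_nonneg_left (by nlinarith) (by linarith)
  · have hR0 : 0 ≤ R := hR.nonneg (φ.symm (e w))
    have hp : 0 ≤ ‖w - w'‖ ^ γ := Real.rpow_nonneg (norm_nonneg _) _
    refine (norm_iteratedFDeriv_comp_sub_le_compConst hj (e₁ := R * (C * ‖w - w'‖ ^ γ))
      (e₂ := C * ‖w - w'‖ ^ γ)
      (hF _ (he.mapsTo w hw)) (hF _ (he.mapsTo w' hw')) (hek w hw) (hek w' hw') hC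
      (hFR _ (he.mapsTo w hw)) (heC w hw) (heC w' hw') (fun j hj => ?_) fun j hj => ?_).trans ?_
    · refine (hFL _ (he.mapsTo w hw) _ (he.mapsTo w' hw') j hj).trans ?_
      gcongr
      refine le_trans ?_ (Real.mul_rpow_le_mul_rpow hC (norm_nonneg _) hγ1)
      gcongr
      have := heL w hw w' hw' 0 (Nat.zero_le _)
      rwa [norm_iteratedFDeriv_zero_sub] at this
    · refine (heL w hw w' hw' j hj).trans ?_
      gcongr
      exact hw1 w hw w' hw'
    · apply le_of_eq
      ring

/-- The radius and the constant do not depend on `G`, so the composition estimates built on this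
extension are uniform over all maps. -/
theorem Background.exists_local_extension [CompactSpace M] (B : Background d M) (k m : ℕ) {γ : ℝ}
    (hγ0 : 0 ≤ γ) (hγ1 : γ ≤ 1) :
    ∃ δ > 0, δ ≤ 1 / 2 ∧ ∃ C ≥ 1, ∀ (G : M → EuclideanSpace ℝ (Fin m)) (R : ℝ),
      ContMDiff (𝓡 d) (𝓡 m) k G → HolderBound B k γ G R → ∀ t,
        ∃ f : EuclideanSpace ℝ (Fin B.dim) → EuclideanSpace ℝ (Fin m),
          IsHolderOn k γ f (Metric.ball (B.emb t) δ) (C * R) ∧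
          ∀ t', B.emb t' ∈ Metric.ball (B.emb t) δ → f (B.emb t') = G t' := by
  obtain ⟨δ, hδ, hδ1, C, hC, h⟩ := B.exists_isLocalRetraction (Nat.succ_ne_zero k)
  refine ⟨δ, hδ, hδ1, compConst k * (2 * C ^ (k + 1)), ?_, fun G R hG hR t => ?_⟩
  · have h1 := one_le_compConst k
    have h2 : 1 ≤ C ^ (k + 1) := one_le_pow₀ hC
    nlinarith
  · obtain ⟨i, e, Ω, he⟩ := h t
    refine ⟨_, he.isHolderOn_comp hγ0 hγ1 hδ1 hC hG hR, fun t' ht' => ?_⟩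
    simp [he.left_inv t' ht']

/-- A core need not be convex, so the mean value inequality cannot be used inside it. For close
points it is applied on a ball that may leave the core, where the local extension still bounds the
derivatives; for distant points the sup bound suffices. -/
theorem Background.exists_norm_chartDeriv_sub_le [CompactSpace M] (B : Background d M) (k m : ℕ)
    {γ : ℝ} (hγ0 : 0 ≤ γ) (hγ1 : γ ≤ 1) :
    ∃ C ≥ 1, ∀ (G : M → EuclideanSpace ℝ (Fin m)) (R : ℝ),
      ContMDiff (𝓡 d) (𝓡 m) k G → HolderBound B k γ G R → ∀ i, ∀ t ∈ B.core i, ∀ t' ∈ B.core i,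
        ∀ j < k, ‖chartDeriv (B.chart i) j G t - chartDeriv (B.chart i) j G t'‖ ≤
          C * R * dist (B.chart i t) (B.chart i t') := by
  obtain ⟨δ, hδ, hδ1, C₂, hC₂, hext⟩ := B.exists_local_extension k m hγ0 hγ1
  suffices h : ∀ i, ∀ᶠ C in atTop, ∀ (G : M → EuclideanSpace ℝ (Fin m)) (R : ℝ),
      ContMDiff (𝓡 d) (𝓡 m) k G → HolderBound B k γ G R → ∀ t ∈ B.core i, ∀ t' ∈ B.core i,
        ∀ j < k, ‖chartDeriv (B.chart i) j G t - chartDeriv (B.chart i) j G t'‖ ≤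
          C * R * dist (B.chart i t) (B.chart i t') by
    obtain ⟨C, hC, hC1⟩ := ((eventually_all.2 h).and (eventually_ge_atTop 1)).exists
    exact ⟨C, hC1, fun G R hG hR i => hC i G R hG hR⟩
  intro i
  set φ := B.chart i with hφ
  set h := B.emb ∘ φ.symm with hh
  have hQ : IsCompact (φ '' B.core i) :=
    (B.core_compact i).image_of_continuousOn (φ.continuousOn.mono (B.core_subset i))
  have hQt : φ '' B.core i ⊆ φ.target := by
    rintro _ ⟨t, ht, rfl⟩
    exact φ.map_source (B.core_subset i ht)
  obtain ⟨η, hη, hηt⟩ := hQ.exists_cthickening_subset_open φ.open_target hQt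
  have hK : IsCompact (Metric.cthickening η (φ '' B.core i)) := hQ.cthickening
  have hsm : ∀ y ∈ φ.target, ContDiffAt ℝ ∞ h y := fun y hy =>
    B.contDiffAt_comp_symm i le_rfl B.emb_smooth hy
  obtain ⟨C₁, hC₁, hC₁1⟩ : ∃ C₁ : ℝ, (∀ j ∈ Iic (k + 1),
      ∀ y ∈ Metric.cthickening η (φ '' B.core i), ‖iteratedFDeriv ℝ j h y‖ ≤ C₁) ∧ 1 ≤ C₁ := by
    refine (((eventually_all_finite (finite_Iic (k + 1))).2 fun j _ => ?_).and
      (eventually_ge_atTop (1 : ℝ))).exists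
    have hcont : ContinuousOn (iteratedFDeriv ℝ j h) (Metric.cthickening η (φ '' B.core i)) :=
      fun y hy => ((hsm y (hηt hy)).continuousAt_iteratedFDeriv
        (natCast_le_infty j)).continuousWithinAt
    obtain ⟨c, hc⟩ := hK.exists_bound_of_continuousOn hcont
    filter_upwards [eventually_ge_atTop c] with C hC y hy
    exact (hc y hy).trans hC
  -- Small enough that the ball stays in the chart and that `h`, with Lipschitz constant `C₁`, maps
  -- it into the `δ`-ball of the extension.
  set η' := min η (δ / (2 * C₁)) with hη'
  have hη'0 : 0 < η' := lt_min hη (by positivity)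
  filter_upwards [eventually_ge_atTop (compConst k * (C₂ * C₁ ^ k) + 2 / η')] with
    C hC G R hG hR t ht t' ht' j hj
  have hR0 : 0 ≤ R := hR.nonneg t
  have hcc := one_le_compConst k
  have hA : 0 ≤ compConst k * (C₂ * C₁ ^ k) := by positivity
  set p := dist (φ t) (φ t') with hp
  have hp0 : 0 ≤ p := dist_nonneg
  rcases lt_or_ge p η' with hlt | hge
  · obtain ⟨f, hf, hfG⟩ := hext G R hG hR t
    have hball : Metric.ball (φ t) η' ⊆ Metric.cthickening η (φ '' B.core i) :=
      (Metric.ball_subset_ball (min_le_left _ _)).trans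
        ((Metric.ball_subset_thickening (mem_image_of_mem _ ht) η).trans
          (Metric.thickening_subset_cthickening _ _))
    have hht : h (φ t) = B.emb t := by simp [hh, φ.left_inv (B.core_subset i ht)]
    have hmaps : ∀ y ∈ Metric.ball (φ t) η', h y ∈ Metric.ball (B.emb t) δ := by
      intro y hy
      have h1 := (convex_ball (φ t) η').norm_iteratedFDeriv_sub_le (k := k + 1) (R := C₁)
        (Nat.succ_pos k) (f := h) (fun x hx => (hsm x (hηt (hball hx))).of_le (natCast_le_infty _))
        (fun x hx => hC₁ _ (by simp) x (hball hx)) hy (Metric.mem_ball_self hη'0)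
      rw [norm_iteratedFDeriv_zero_sub, hht] at h1
      rw [Metric.mem_ball, dist_eq_norm]
      have h2 : ‖y - φ t‖ < δ / (2 * C₁) := by
        rw [← dist_eq_norm]
        exact (Metric.mem_ball.1 hy).trans_le (min_le_right _ _)
      have h3 : C₁ * (δ / (2 * C₁)) = δ / 2 := by field_simp
      nlinarith
    have hloc : ∀ y ∈ Metric.ball (φ t) η', G ∘ φ.symm =ᶠ[𝓝 y] f ∘ h := by
      intro y hy
      filter_upwards [Metric.isOpen_ball.mem_nhds hy] with z hz
      exact (hfG _ (hmaps z hz)).symm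
    have hbd : ∀ y ∈ Metric.ball (φ t) η', ∀ l ≤ k,
        ‖iteratedFDeriv ℝ l (G ∘ φ.symm) y‖ ≤ compConst k * (C₂ * R * C₁ ^ k) := by
      intro y hy l hl
      rw [((hloc y hy).iteratedFDeriv ℝ l).eq_of_nhds]
      exact norm_iteratedFDeriv_comp_le_compConst hl (hf.contDiffAt _ (hmaps y hy))
        ((hsm y (hηt (hball hy))).of_le (natCast_le_infty _)) hC₁1 (hf.norm_le _ (hmaps y hy))
        fun l' hl' => hC₁ l' (by simp; omega) y (hball hy)
    have h1 := (convex_ball (φ t) η').norm_iteratedFDeriv_sub_le hj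
      (fun y hy => B.contDiffAt_comp_symm i (natCast_le_infty k) hG (hηt (hball hy)))
      (fun y hy => hbd y hy (j + 1) hj) (Metric.mem_ball_self hη'0)
      (y := φ t') (by rw [Metric.mem_ball, dist_comm]; exact hlt)
    refine h1.trans ?_
    rw [← dist_eq_norm]
    have h2 : compConst k * (C₂ * R * C₁ ^ k) ≤ C * R := by
      have : 0 ≤ 2 / η' := by positivity
      nlinarith
    gcongr
  · have h1 : ‖chartDeriv φ j G t - chartDeriv φ j G t'‖ ≤ 2 * R := by
      refine (norm_sub_le _ _).trans ?_
      have := hR.norm_le i j hj.le t ht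
      have := hR.norm_le i j hj.le t' ht'
      linarith
    have h2 : 2 ≤ 2 / η' * p := by
      rw [div_mul_eq_mul_div, le_div_iff₀ hη'0]
      linarith
    have h3 : 2 / η' * p ≤ C * p := by
      gcongr
      linarith
    nlinarith

end Background

end DiffCocycle

/-! ### Interpolation inequalities for real powers. -/

section Auxiliary

theorem Real.le_mul_rpow_sub_of_le_of_le {z L D γ α : ℝ} (hL : 0 ≤ L) (hD : 0 ≤ D)
    (hα : 0 ≤ α) (hαγ : α ≤ γ) (h1 : z ≤ L * D ^ γ) (h2 : z ≤ L) : z ≤ L * D ^ (γ - α) := by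
  rcases le_total D 1 with h | h
  · rcases hD.eq_or_lt with rfl | hD0
    · refine h1.trans (mul_le_mul_of_nonneg_left ?_ hL)
      rcases (hα.trans hαγ).eq_or_lt with h0 | h0
      · have : γ - α = 0 := by linarith
        rw [this, ← h0]
      · rw [Real.zero_rpow h0.ne']
        exact Real.rpow_nonneg le_rfl _
    · refine h1.trans (mul_le_mul_of_nonneg_left ?_ hL)
      exact Real.rpow_le_rpow_of_exponent_ge hD0 h (by linarith)
  · exact h2.trans (le_mul_of_one_le_right hL (Real.one_le_rpow h (by linarith)))

theorem Real.le_mul_rpow_of_le_of_le {z L D γ : ℝ} (hz : 0 ≤ z) (hL : 1 ≤ L) (hγ0 : 0 ≤ γ)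
    (hγ1 : γ ≤ 1) (h1 : z ≤ D) (h2 : z ≤ L) : z ≤ L * D ^ γ := by
  calc z = L * (z / L) := by field_simp
    _ ≤ L * (z / L) ^ γ := by
        gcongr
        exact Real.self_le_rpow (by positivity) (by rw [div_le_one (by linarith)]; exact h2) hγ1
    _ ≤ L * D ^ γ := by
        gcongr
        exact (div_le_self hz hL).trans h1

/-- The two bounds combine to `L * (min D p) ^ γ`; splitting the exponent as `(γ - α) + α` trades
part of the Hölder regularity in `p` for smallness in `D`. -/
theorem Real.le_mul_rpow_mul_rpow {z L D p γ α : ℝ} (hL : 0 ≤ L) (hD : 0 ≤ D) (hp : 0 ≤ p)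
    (hα : 0 ≤ α) (hαγ : α ≤ γ) (h1 : z ≤ L * D ^ γ) (h2 : z ≤ L * p ^ γ) :
    z ≤ L * (D ^ (γ - α) * p ^ α) := by
  have hq : z ≤ L * (min D p) ^ γ := by
    rcases min_choice D p with h | h <;> rw [h] <;> assumption
  refine hq.trans (mul_le_mul_of_nonneg_left ?_ hL)
  have hm : 0 ≤ min D p := le_min hD hp
  calc (min D p) ^ γ = (min D p) ^ (γ - α) * (min D p) ^ α := by
        rw [← Real.rpow_add_of_nonneg hm (by linarith) hα]; simp
    _ ≤ D ^ (γ - α) * p ^ α := by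
        exact mul_le_mul (Real.rpow_le_rpow hm (min_le_left _ _) (by linarith))
          (Real.rpow_le_rpow hm (min_le_right _ _) hα) (Real.rpow_nonneg hm _)
          (Real.rpow_nonneg hD _)

end Auxiliary

/-! ### Composition operators between Hölder spaces. -/

namespace DiffCocycle

section Background

variable {d : ℕ} {M : Type*} [TopologicalSpace M] [ChartedSpace (EuclideanSpace ℝ (Fin d)) M]
  {B : Background d M}

theorem comp_symm_eventuallyEq {i : Fin B.num} {m : ℕ} {δ : ℝ}
    {w : EuclideanSpace ℝ (Fin B.dim)} {F : M → EuclideanSpace ℝ (Fin m)} {g : M → M}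
    {f : EuclideanSpace ℝ (Fin B.dim) → EuclideanSpace ℝ (Fin m)}
    (hf : ∀ t', B.emb t' ∈ Metric.ball w δ → f (B.emb t') = F t') (hg : Continuous g) {t : M}
    (ht : t ∈ B.core i) (hw : B.emb (g t) ∈ Metric.ball w δ) :
    (fun s => F (g s)) ∘ (B.chart i).symm =ᶠ[𝓝 (B.chart i t)]
      f ∘ ((fun s => B.emb (g s)) ∘ (B.chart i).symm) := by
  have hts := B.core_subset i ht
  have hc : ContinuousAt ((fun s => B.emb (g s)) ∘ (B.chart i).symm) (B.chart i t) :=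
    (B.emb_smooth.continuous.comp hg).continuousAt.comp
      ((B.chart i).continuousAt_symm ((B.chart i).map_source hts))
  have hw' : ((fun s => B.emb (g s)) ∘ (B.chart i).symm) (B.chart i t) ∈ Metric.ball w δ := by
    simpa [(B.chart i).left_inv hts] using hw
  filter_upwards [hc (Metric.isOpen_ball.mem_nhds hw')] with y hy
  exact (hf _ hy).symm

variable {k m : ℕ} {γ : ℝ}

theorem contDiffAt_emb_comp {g : M → M} (hg : ContMDiff (𝓡 d) (𝓡 d) k g) (i : Fin B.num) {t : M}
    (ht : t ∈ B.core i) :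
    ContDiffAt ℝ k ((fun s => B.emb (g s)) ∘ (B.chart i).symm) (B.chart i t) :=
  B.contDiffAt_comp_symm i (natCast_le_infty k)
    ((B.emb_smooth.of_le (natCast_le_infty k)).comp hg)
    ((B.chart i).map_source (B.core_subset i ht))

/-- Comparison of two compositions with a map that extends to a Hölder map of the ambient space. -/
theorem norm_chartDeriv_comp_sub_le {m : ℕ} {δ S R q e : ℝ} (hγ0 : 0 ≤ γ) (hR : 1 ≤ R)
    {w : EuclideanSpace ℝ (Fin B.dim)} {F : M → EuclideanSpace ℝ (Fin m)} {g₁ g₂ : M → M}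
    {f : EuclideanSpace ℝ (Fin B.dim) → EuclideanSpace ℝ (Fin m)}
    (hf : IsHolderOn k γ f (Metric.ball w δ) S)
    (hfF : ∀ t', B.emb t' ∈ Metric.ball w δ → f (B.emb t') = F t')
    (hg₁ : ContMDiff (𝓡 d) (𝓡 d) k g₁) (hg₂ : ContMDiff (𝓡 d) (𝓡 d) k g₂) {i : Fin B.num}
    {t₁ t₂ : M} (ht₁ : t₁ ∈ B.core i) (ht₂ : t₂ ∈ B.core i)
    (hw₁ : B.emb (g₁ t₁) ∈ Metric.ball w δ) (hw₂ : B.emb (g₂ t₂) ∈ Metric.ball w δ)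
    (hR₁ : ∀ l ≤ k, ‖chartDeriv (B.chart i) l (fun t => B.emb (g₁ t)) t₁‖ ≤ R)
    (hR₂ : ∀ l ≤ k, ‖chartDeriv (B.chart i) l (fun t => B.emb (g₂ t)) t₂‖ ≤ R)
    (hq : ‖B.emb (g₁ t₁) - B.emb (g₂ t₂)‖ ≤ q)
    (he : ∀ l ≤ k, ‖chartDeriv (B.chart i) l (fun t => B.emb (g₁ t)) t₁ -
      chartDeriv (B.chart i) l (fun t => B.emb (g₂ t)) t₂‖ ≤ e) {j : ℕ} (hj : j ≤ k) :
    ‖chartDeriv (B.chart i) j (fun t => F (g₁ t)) t₁ -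
      chartDeriv (B.chart i) j (fun t => F (g₂ t)) t₂‖ ≤
      compConst k * (R ^ k * (S * q ^ γ + S * e)) := by
  have hwe : ((fun s => B.emb (g₁ s)) ∘ (B.chart i).symm) (B.chart i t₁) = B.emb (g₁ t₁) := by
    simp [(B.chart i).left_inv (B.core_subset i ht₁)]
  have hve : ((fun s => B.emb (g₂ s)) ∘ (B.chart i).symm) (B.chart i t₂) = B.emb (g₂ t₂) := by
    simp [(B.chart i).left_inv (B.core_subset i ht₂)]
  have hw' := hwe.symm ▸ hw₁
  have hv' := hve.symm ▸ hw₂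
  rw [chartDeriv, chartDeriv,
    ((comp_symm_eventuallyEq hfF hg₁.continuous ht₁ hw₁).iteratedFDeriv ℝ j).eq_of_nhds,
    ((comp_symm_eventuallyEq hfF hg₂.continuous ht₂ hw₂).iteratedFDeriv ℝ j).eq_of_nhds]
  refine norm_iteratedFDeriv_comp_sub_le_compConst hj
    (hf.contDiffAt _ hw') (hf.contDiffAt _ hv')
    (contDiffAt_emb_comp hg₁ i ht₁) (contDiffAt_emb_comp hg₂ i ht₂) hR (hf.norm_le _ hw')
    hR₁ hR₂ (fun l hl => ?_) he
  have hS : 0 ≤ S := (norm_nonneg _).trans (hf.norm_le _ hw' l hl)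
  refine (hf.sub_le _ hw' _ hv' l hl).trans ?_
  rw [hwe, hve]
  gcongr

/-- Composition with a diffeomorphism on the right is bounded, polynomially in the size of the
diffeomorphism, between Hölder spaces. -/
theorem Background.exists_holderBound_comp [CompactSpace M] (B : Background d M) (k m : ℕ)
    (hk : 1 ≤ k) (hγ0 : 0 ≤ γ) (hγ1 : γ ≤ 1) :
    ∃ C ≥ 1, ∀ (F : M → EuclideanSpace ℝ (Fin m)) (g : M → M) (S R : ℝ),
      ContMDiff (𝓡 d) (𝓡 m) k F → ContMDiff (𝓡 d) (𝓡 d) k g → 1 ≤ R →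
      HolderBound B k γ F S → HolderBound B k γ (fun t => B.emb (g t)) R →
      HolderBound B k γ (fun t => F (g t)) (C * (S * R ^ (k + 1))) := by
  obtain ⟨δ, hδ, hδ1, C₂, hC₂, hext⟩ := B.exists_local_extension k m hγ0 hγ1
  obtain ⟨C₃, hC₃, hlip⟩ := B.exists_norm_chartDeriv_sub_le k B.dim hγ0 hγ1
  have hcc := one_le_compConst k
  have hC₃δ : 1 ≤ C₃ / δ := by
    rw [le_div_iff₀ hδ]; linarith
  have hCC : 1 ≤ compConst k * C₂ := one_le_mul_of_one_le_of_one_le hcc hC₂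
  refine ⟨2 * (compConst k * C₂) * (C₃ / δ), by
    linarith [one_le_mul_of_one_le_of_one_le hCC hC₃δ], fun F g S R hF hg hR hFS hgR => ?_⟩
  have hu : ContMDiff (𝓡 d) (𝓡 B.dim) k (fun t => B.emb (g t)) :=
    (B.emb_smooth.of_le (natCast_le_infty k)).comp hg
  have hRk : R ^ k ≤ R ^ (k + 1) := pow_le_pow_right₀ hR (Nat.le_succ k)
  have hsup : ∀ i, ∀ j ≤ k, ∀ t ∈ B.core i,
      ‖chartDeriv (B.chart i) j (fun t => F (g t)) t‖ ≤ compConst k * (C₂ * S * R ^ k) := by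
    intro i j hj t ht
    obtain ⟨f, hf, hfF⟩ := hext F S hF hFS (g t)
    have hw : B.emb (g t) ∈ Metric.ball (B.emb (g t)) δ := Metric.mem_ball_self hδ
    have hw' : ((fun s => B.emb (g s)) ∘ (B.chart i).symm) (B.chart i t) ∈
        Metric.ball (B.emb (g t)) δ := by
      simpa [(B.chart i).left_inv (B.core_subset i ht)] using hδ
    rw [chartDeriv, ((comp_symm_eventuallyEq hfF hg.continuous ht hw).iteratedFDeriv ℝ j).eq_of_nhds]
    exact norm_iteratedFDeriv_comp_le_compConst hj (hf.contDiffAt _ hw')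
      (contDiffAt_emb_comp hg i ht) hR (hf.norm_le _ hw') fun l hl => hgR.norm_le i l hl t ht
  refine ⟨fun i j hj t ht => (hsup i j hj t ht).trans ?_, fun i t ht t' ht' => ?_⟩
  · have hS := hFS.nonneg t
    calc compConst k * (C₂ * S * R ^ k) = 1 * (compConst k * C₂) * 1 * (S * R ^ k) := by ring
      _ ≤ 2 * (compConst k * C₂) * (C₃ / δ) * (S * R ^ (k + 1)) := by
        gcongr
        norm_num
  · have hS := hFS.nonneg t
    set p := dist (B.chart i t) (B.chart i t') with hp
    have hp0 : 0 ≤ p := dist_nonneg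
    have hpγ : 0 ≤ p ^ γ := Real.rpow_nonneg hp0 _
    have hlip0 : ‖B.emb (g t') - B.emb (g t)‖ ≤ C₃ * R * p := by
      rw [← norm_neg, neg_sub, ← norm_chartDeriv_zero_sub i ht ht' (fun t => B.emb (g t))
        (fun t => B.emb (g t))]
      exact hlip _ R hu hgR i t ht t' ht' 0 hk
    -- If the images are close, one local extension covers both. Otherwise `p` is at least `δ / (C₃
    -- * R)` and twice the sup bound suffices. Either case costs one more factor `R`, hence the
    -- exponent `k + 1`.
    rcases lt_or_ge (C₃ * R * p) δ with hlt | hge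
    · obtain ⟨f, hf, hfF⟩ := hext F S hF hFS (g t)
      have hw : B.emb (g t) ∈ Metric.ball (B.emb (g t)) δ := Metric.mem_ball_self hδ
      have hv : B.emb (g t') ∈ Metric.ball (B.emb (g t)) δ := by
        rw [Metric.mem_ball, dist_eq_norm]
        exact hlip0.trans_lt hlt
      have hp1 : p ≤ p ^ γ := by
        refine Real.self_le_rpow hp0 ?_ hγ1
        have h1 : 1 ≤ C₃ * R := one_le_mul_of_one_le_of_one_le hC₃ hR
        nlinarith
      refine (norm_chartDeriv_comp_sub_le hγ0 hR hf hfF hg hg ht ht' hw hv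
        (fun l hl => hgR.norm_le i l hl t ht) (fun l hl => hgR.norm_le i l hl t' ht')
        (q := C₃ * R * p) (e := C₃ * R * p ^ γ) (by rw [← norm_neg, neg_sub]; exact hlip0)
        (fun l hl => ?_) le_rfl).trans ?_
      · rcases hl.lt_or_eq with hl | rfl
        · refine (hlip _ R hu hgR i t ht t' ht' l hl).trans ?_
          gcongr
        · refine (hgR.sub_le i t ht t' ht').trans ?_
          gcongr
          nlinarith
      · have h5 : (C₃ * R * p) ^ γ ≤ C₃ * R * p ^ γ := Real.mul_rpow_le_mul_rpow
          (one_le_mul_of_one_le_of_one_le hC₃ hR) hp0 hγ1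
        calc compConst k * (R ^ k * (C₂ * S * (C₃ * R * p) ^ γ + C₂ * S * (C₃ * R * p ^ γ)))
            ≤ compConst k * (R ^ k * (C₂ * S * (C₃ * R * p ^ γ) + C₂ * S * (C₃ * R * p ^ γ))) := by
              gcongr
          _ = 2 * (compConst k * C₂) * C₃ * (S * R ^ (k + 1)) * p ^ γ := by ring
          _ ≤ 2 * (compConst k * C₂) * (C₃ / δ) * (S * R ^ (k + 1)) * p ^ γ := by
            gcongr
            exact le_div_self (by linarith) hδ (by linarith)
    · have h1 : 1 ≤ C₃ / δ * R * p ^ γ := by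
        have h2 : 1 ≤ C₃ / δ * R * p := by
          calc 1 ≤ (C₃ * R * p) / δ := by rwa [le_div_iff₀ hδ, one_mul]
            _ = C₃ / δ * R * p := by ring
        exact (Real.one_le_rpow h2 hγ0).trans (Real.mul_rpow_le_mul_rpow
          (one_le_mul_of_one_le_of_one_le hC₃δ hR) hp0 hγ1)
      have h3 := hsup i k le_rfl t ht
      have h4 := hsup i k le_rfl t' ht'
      refine (norm_sub_le _ _).trans ?_
      calc _ ≤ 2 * (compConst k * (C₂ * S * R ^ k)) * 1 := by linarith
        _ ≤ 2 * (compConst k * (C₂ * S * R ^ k)) * (C₃ / δ * R * p ^ γ) := by gcongr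
        _ = _ := by ring

/-- Composition with `F` on the left is Hölder continuous, with a loss of `γ - α` derivatives. -/
theorem Background.exists_holderBound_comp_sub [CompactSpace M] (B : Background d M) (k m : ℕ)
    (hk : 1 ≤ k) {α : ℝ} (hα : 0 ≤ α) (hαγ : α ≤ γ) (hγ1 : γ ≤ 1) :
    ∃ C ≥ 1, ∀ (F : M → EuclideanSpace ℝ (Fin m)) (g₁ g₂ : M → M) (R D : ℝ),
      ContMDiff (𝓡 d) (𝓡 m) k F → ContMDiff (𝓡 d) (𝓡 d) k g₁ → ContMDiff (𝓡 d) (𝓡 d) k g₂ →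
      1 ≤ R → HolderBound B k γ F R → HolderBound B k γ (fun t => B.emb (g₁ t)) R →
      HolderBound B k γ (fun t => B.emb (g₂ t)) R →
      HolderBound B k γ (fun t => B.emb (g₁ t) - B.emb (g₂ t)) D →
      HolderBound B k α (fun t => F (g₁ t) - F (g₂ t)) (C * R ^ (k + 2) * D ^ (γ - α)) := by
  have hγ0 : 0 ≤ γ := hα.trans hαγ
  obtain ⟨δ, hδ, hδ1, C₂, hC₂, hext⟩ := B.exists_local_extension k m hγ0 hγ1
  obtain ⟨C₃, hC₃, hcomp⟩ := B.exists_holderBound_comp k m hk hγ0 hγ1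
  have hcc := one_le_compConst k
  have hC₃δ : C₃ ≤ C₃ / δ := le_div_self (by linarith) hδ (by linarith)
  set C₄ := 3 * compConst k * C₂ + 2 * (C₃ / δ) with hC₄
  have hC₄0 : 0 ≤ 3 * compConst k * C₂ := by positivity
  refine ⟨2 * C₄, by linarith, fun F g₁ g₂ R D hF hg₁ hg₂ hR hFR hgR₁ hgR₂ hD => ?_⟩
  have hu : ∀ {g : M → M}, ContMDiff (𝓡 d) (𝓡 d) k g →
      ContMDiff (𝓡 d) (𝓡 B.dim) k (fun t => B.emb (g t)) := fun hg =>
    (B.emb_smooth.of_le (natCast_le_infty k)).comp hg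
  have hb₁ := hcomp F g₁ R R hF hg₁ hR hFR hgR₁
  have hb₂ := hcomp F g₂ R R hF hg₂ hR hFR hgR₂
  set S := C₃ * (R * R ^ (k + 1)) with hS
  have hRk : 1 ≤ R ^ k := one_le_pow₀ hR
  have hRk2 : 1 ≤ R ^ (k + 2) := one_le_pow₀ hR
  have hSe : S = C₃ * R ^ (k + 2) := by rw [hS]; ring
  set L := C₄ * R ^ (k + 2) with hL
  have hL0 : 0 ≤ L := by positivity
  have hSL : 2 * S ≤ L := by
    rw [hSe, hL, hC₄]
    nlinarith
  have hs₁ : ContMDiff (𝓡 d) (𝓡 m) k (fun t => F (g₁ t)) := hF.comp hg₁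
  have hs₂ : ContMDiff (𝓡 d) (𝓡 m) k (fun t => F (g₂ t)) := hF.comp hg₂
  have htriv : ∀ i, ∀ j ≤ k, ∀ t ∈ B.core i,
      ‖chartDeriv (B.chart i) j (fun t => F (g₁ t) - F (g₂ t)) t‖ ≤ 2 * S := by
    intro i j hj t ht
    rw [chartDeriv_sub i hj hs₁ hs₂ ht]
    refine (norm_sub_le _ _).trans ?_
    linarith [hb₁.norm_le i j hj t ht, hb₂.norm_le i j hj t ht]
  have hsup : ∀ i, ∀ j ≤ k, ∀ t ∈ B.core i,
      ‖chartDeriv (B.chart i) j (fun t => F (g₁ t) - F (g₂ t)) t‖ ≤ L * D ^ γ := by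
    intro i j hj t ht
    have hD0 := hD.nonneg t
    have hDγ : 0 ≤ D ^ γ := Real.rpow_nonneg hD0 _
    have hdist : ‖B.emb (g₂ t) - B.emb (g₁ t)‖ ≤ D := by
      rw [← norm_neg, neg_sub]
      exact hD.norm_apply_le t
    rcases lt_or_ge ‖B.emb (g₂ t) - B.emb (g₁ t)‖ δ with hlt | hge
    · obtain ⟨f, hf, hfF⟩ := hext F R hF hFR (g₁ t)
      have hw : B.emb (g₁ t) ∈ Metric.ball (B.emb (g₁ t)) δ := Metric.mem_ball_self hδ
      have hv : B.emb (g₂ t) ∈ Metric.ball (B.emb (g₁ t)) δ := by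
        rwa [Metric.mem_ball, dist_eq_norm]
      rw [chartDeriv_sub i hj hs₁ hs₂ ht]
      refine (norm_chartDeriv_comp_sub_le hγ0 hR hf hfF hg₁ hg₂ ht ht hw hv
        (fun l hl => hgR₁.norm_le i l hl t ht) (fun l hl => hgR₂.norm_le i l hl t ht)
        (q := D) (e := 2 * R * D ^ γ) (by rw [← norm_neg, neg_sub]; exact hdist)
        (fun l hl => ?_) hj).trans ?_
      -- The differences of the inner derivatives are bounded both by `D` and by `2 * R`; together
      -- these give `2 * R * D ^ γ`, even for large `D`.
      · refine Real.le_mul_rpow_of_le_of_le (norm_nonneg _) (by linarith) hγ0 hγ1 ?_ ?_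
        · have := hD.norm_le i l hl t ht
          rwa [chartDeriv_sub i hl (hu hg₁) (hu hg₂) ht] at this
        · have h1 := hgR₁.norm_le i l hl t ht
          have h2 := hgR₂.norm_le i l hl t ht
          exact (norm_sub_le _ _).trans (by linarith)
      · calc compConst k * (R ^ k * (C₂ * R * D ^ γ + C₂ * R * (2 * R * D ^ γ)))
            = compConst k * C₂ * (R ^ k * (R * 1 + 2 * R * R)) * D ^ γ := by ring
          _ ≤ compConst k * C₂ * (R ^ k * (R * R + 2 * R * R)) * D ^ γ := by gcongr
          _ = 3 * compConst k * C₂ * R ^ (k + 2) * D ^ γ := by ring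
          _ ≤ L * D ^ γ := by
            rw [hL, hC₄]
            gcongr
            have : 0 ≤ 2 * (C₃ / δ) := by positivity
            linarith
    · refine (htriv i j hj t ht).trans ?_
      have h1 : 1 ≤ 1 / δ * D ^ γ := by
        have h2 : 1 ≤ 1 / δ * D := by
          rw [one_div, inv_mul_eq_div, le_div_iff₀ hδ]
          linarith
        exact (Real.one_le_rpow h2 hγ0).trans (Real.mul_rpow_le_mul_rpow
          (by rw [le_div_iff₀ hδ]; linarith) hD0 hγ1)
      calc 2 * S ≤ 2 * S * (1 / δ * D ^ γ) := le_mul_of_one_le_right (by positivity) h1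
        _ = 2 * (C₃ / δ) * R ^ (k + 2) * D ^ γ := by rw [hSe]; ring
        _ ≤ L * D ^ γ := by
            rw [hL, hC₄]
            gcongr
            linarith
  refine ⟨fun i j hj t ht => ?_, fun i t ht t' ht' => ?_⟩
  · have hD0 := hD.nonneg t
    refine (Real.le_mul_rpow_sub_of_le_of_le hL0 hD0 hα hαγ (hsup i j hj t ht)
      ((htriv i j hj t ht).trans hSL)).trans ?_
    have : 0 ≤ D ^ (γ - α) := Real.rpow_nonneg hD0 _
    gcongr
    rw [hL]
    linarith
  · have hD0 := hD.nonneg t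
    have h1 : 2 * L * (D ^ (γ - α) * dist (B.chart i t) (B.chart i t') ^ α) =
        2 * C₄ * R ^ (k + 2) * D ^ (γ - α) * dist (B.chart i t) (B.chart i t') ^ α := by
      rw [hL]; ring
    rw [← h1]
    -- Interpolation: the sup bound gives `D ^ γ`, and the `C^{k+γ}` bounds of the two compositions
    -- separately give `p ^ γ`.
    refine Real.le_mul_rpow_mul_rpow (by linarith) hD0 dist_nonneg hα hαγ ?_ ?_
    · refine (norm_sub_le _ _).trans ?_
      linarith [hsup i k le_rfl t ht, hsup i k le_rfl t' ht']
    · rw [chartDeriv_sub i le_rfl hs₁ hs₂ ht, chartDeriv_sub i le_rfl hs₁ hs₂ ht',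
        sub_sub_sub_comm]
      refine (norm_sub_le _ _).trans ?_
      have h2 := hb₁.sub_le i t ht t' ht'
      have h3 := hb₂.sub_le i t ht t' ht'
      have h4 : 0 ≤ dist (B.chart i t) (B.chart i t') ^ γ := Real.rpow_nonneg dist_nonneg _
      nlinarith

end Background

end DiffCocycle

namespace DiffCocycle

/-! ### Algebra of Hölder bounds and limits in Hölder spaces -/

section Background

variable {d : ℕ} {M : Type*} [TopologicalSpace M] [ChartedSpace (EuclideanSpace ℝ (Fin d)) M]
  {B : Background d M} {k m : ℕ} {α γ : ℝ}

theorem HolderBound.mono {G : M → EuclideanSpace ℝ (Fin m)} {R R' : ℝ}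
    (h : HolderBound B k α G R) (hR : R ≤ R') : HolderBound B k α G R' :=
  ⟨fun i j hj t ht => (h.norm_le i j hj t ht).trans hR, fun i t ht t' ht' =>
    (h.sub_le i t ht t' ht').trans
      (mul_le_mul_of_nonneg_right hR (Real.rpow_nonneg dist_nonneg _))⟩

theorem chartDeriv_add (i : Fin B.num) {j : ℕ} (hj : j ≤ k)
    {G G' : M → EuclideanSpace ℝ (Fin m)} (hG : ContMDiff (𝓡 d) (𝓡 m) k G)
    (hG' : ContMDiff (𝓡 d) (𝓡 m) k G') {t : M} (ht : t ∈ B.core i) :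
    chartDeriv (B.chart i) j (fun s => G s + G' s) t =
      chartDeriv (B.chart i) j G t + chartDeriv (B.chart i) j G' t := by
  have hy := (B.chart i).map_source (B.core_subset i ht)
  have h1 := (B.contDiffAt_comp_symm i (natCast_le_infty k) hG hy).of_le
    (by exact_mod_cast hj : (j : WithTop ℕ∞) ≤ k)
  have h2 := (B.contDiffAt_comp_symm i (natCast_le_infty k) hG' hy).of_le
    (by exact_mod_cast hj : (j : WithTop ℕ∞) ≤ k)
  exact iteratedFDeriv_add_apply h1 h2

theorem HolderBound.add {G G' : M → EuclideanSpace ℝ (Fin m)} {R R' : ℝ}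
    (h : HolderBound B k α G R) (h' : HolderBound B k α G' R')
    (hG : ContMDiff (𝓡 d) (𝓡 m) k G) (hG' : ContMDiff (𝓡 d) (𝓡 m) k G') :
    HolderBound B k α (fun t => G t + G' t) (R + R') := by
  refine ⟨fun i j hj t ht => ?_, fun i t ht t' ht' => ?_⟩
  · rw [chartDeriv_add i hj hG hG' ht]
    exact (norm_add_le _ _).trans (add_le_add (h.norm_le i j hj t ht) (h'.norm_le i j hj t ht))
  · rw [chartDeriv_add i le_rfl hG hG' ht, chartDeriv_add i le_rfl hG hG' ht', add_sub_add_comm,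
      add_mul]
    exact (norm_add_le _ _).trans (add_le_add (h.sub_le i t ht t' ht') (h'.sub_le i t ht t' ht'))

theorem HolderBound.sub_add_sub {F G H : M → EuclideanSpace ℝ (Fin m)} {R R' : ℝ}
    (h : HolderBound B k α (fun t => F t - G t) R) (h' : HolderBound B k α (fun t => G t - H t) R')
    (hF : ContMDiff (𝓡 d) (𝓡 m) k F) (hG : ContMDiff (𝓡 d) (𝓡 m) k G)
    (hH : ContMDiff (𝓡 d) (𝓡 m) k H) : HolderBound B k α (fun t => F t - H t) (R + R') := by
  simpa using h.add h' (hF.sub hG) (hG.sub hH)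

theorem HolderBound.of_sub {F G : M → EuclideanSpace ℝ (Fin m)} {R R' : ℝ}
    (h : HolderBound B k α (fun t => F t - G t) R) (h' : HolderBound B k α G R')
    (hF : ContMDiff (𝓡 d) (𝓡 m) k F) (hG : ContMDiff (𝓡 d) (𝓡 m) k G) :
    HolderBound B k α F (R + R') := by
  simpa using h.add h' (hF.sub hG) hG

theorem HolderBound.sub_comm {F G : M → EuclideanSpace ℝ (Fin m)} {R : ℝ}
    (h : HolderBound B k α (fun t => F t - G t) R)
    (hF : ContMDiff (𝓡 d) (𝓡 m) k F) (hG : ContMDiff (𝓡 d) (𝓡 m) k G) :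
    HolderBound B k α (fun t => G t - F t) R := by
  refine ⟨fun i j hj t ht => ?_, fun i t ht t' ht' => ?_⟩
  · rw [chartDeriv_sub i hj hG hF ht, norm_sub_rev, ← chartDeriv_sub i hj hF hG ht]
    exact h.norm_le i j hj t ht
  · have := h.sub_le i t ht t' ht'
    rw [chartDeriv_sub i le_rfl hF hG ht, chartDeriv_sub i le_rfl hF hG ht'] at this
    rw [chartDeriv_sub i le_rfl hG hF ht, chartDeriv_sub i le_rfl hG hF ht', ← norm_neg, neg_sub',
      neg_sub, neg_sub]
    exact this

theorem holderBound_sub_self {G : M → EuclideanSpace ℝ (Fin m)}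
    (hG : ContMDiff (𝓡 d) (𝓡 m) k G) : HolderBound B k α (fun t => G t - G t) 0 := by
  refine ⟨fun i j hj t ht => ?_, fun i t ht t' ht' => ?_⟩
  · rw [chartDeriv_sub i hj hG hG ht]; simp
  · rw [chartDeriv_sub i le_rfl hG hG ht, chartDeriv_sub i le_rfl hG hG ht']; simp

theorem HolderBound.of_exponent_le {G : M → EuclideanSpace ℝ (Fin m)} {R : ℝ}
    (h : HolderBound B k γ G R) (hα : 0 ≤ α) (hαγ : α ≤ γ) : HolderBound B k α G (2 * R) := by
  refine ⟨fun i j hj t ht => (h.norm_le i j hj t ht).trans ?_, fun i t ht t' ht' => ?_⟩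
  · linarith [h.nonneg t]
  · have hR := h.nonneg t
    have h1 : ‖chartDeriv (B.chart i) k G t - chartDeriv (B.chart i) k G t'‖ ≤
        2 * R * (1 : ℝ) ^ γ := by
      rw [Real.one_rpow]
      refine (norm_sub_le _ _).trans ?_
      linarith [h.norm_le i k le_rfl t ht, h.norm_le i k le_rfl t' ht']
    have h2 : ‖chartDeriv (B.chart i) k G t - chartDeriv (B.chart i) k G t'‖ ≤
        2 * R * dist (B.chart i t) (B.chart i t') ^ γ := by
      refine (h.sub_le i t ht t' ht').trans ?_
      gcongr
      linarith
    simpa using Real.le_mul_rpow_mul_rpow (by linarith) zero_le_one dist_nonneg hα hαγ h1 h2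

theorem holderNorm_le_of_holderBound {G : M → EuclideanSpace ℝ (Fin m)} {R : ℝ}
    (hα : 0 ≤ α) (h : HolderBound B k α G R) :
    holderNorm B k α G ≤ ENNReal.ofReal R + ENNReal.ofReal R := by
  refine add_le_add ?_ ?_
  · exact iSup_le fun i => iSup₂_le fun j hj => iSup₂_le fun t ht =>
      ENNReal.ofReal_le_ofReal (h.norm_le i j hj t ht)
  · refine iSup_le fun i => iSup₂_le fun t ht => iSup₂_le fun t' ht' => ?_
    refine ENNReal.div_le_of_le_mul ?_
    rw [edist_dist, ENNReal.ofReal_rpow_of_nonneg dist_nonneg hα,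
      ← ENNReal.ofReal_mul (h.nonneg t)]
    exact ENNReal.ofReal_le_ofReal (h.sub_le i t ht t' ht')

theorem holderBound_of_holderNorm_le {G : M → EuclideanSpace ℝ (Fin m)} {R : ℝ}
    (hα : 0 ≤ α) (hR : 0 ≤ R) (h : holderNorm B k α G ≤ ENNReal.ofReal R) :
    HolderBound B k α G R := by
  have h1 := (le_self_add).trans h
  have h2 := (le_add_self).trans h
  simp only [iSup_le_iff] at h1 h2
  refine ⟨fun i j hj t ht => (ENNReal.ofReal_le_ofReal_iff hR).1 (h1 i j hj t ht),
    fun i t ht t' ht' => ?_⟩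
  have h3 := h2 i t ht t' ht'
  rw [ENNReal.div_le_iff_le_mul (Or.inr ENNReal.ofReal_ne_top)
    (Or.inl (ENNReal.rpow_ne_top_of_nonneg hα (edist_ne_top _ _))), edist_dist,
    ENNReal.ofReal_rpow_of_nonneg dist_nonneg hα, ← ENNReal.ofReal_mul hR] at h3
  exact (ENNReal.ofReal_le_ofReal_iff
    (mul_nonneg hR (Real.rpow_nonneg dist_nonneg _))).1 h3

/-- Pointwise convergence of the derivatives in one chart passes to another chart. -/
theorem tendsto_chartDeriv_of_tendsto {G : ℕ → M → EuclideanSpace ℝ (Fin m)}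
    {g : M → EuclideanSpace ℝ (Fin m)} (hG : ∀ n, ContMDiff (𝓡 d) (𝓡 m) k (G n))
    (hg : ContMDiff (𝓡 d) (𝓡 m) k g) {i i' : Fin B.num} {t : M} (ht : t ∈ B.core i)
    (ht' : t ∈ B.core i')
    (h : ∀ j ≤ k, Tendsto (fun n => chartDeriv (B.chart i) j (G n) t) atTop
      (𝓝 (chartDeriv (B.chart i) j g t))) {j : ℕ} (hj : j ≤ k) :
    Tendsto (fun n => chartDeriv (B.chart i') j (G n) t) atTop
      (𝓝 (chartDeriv (B.chart i') j g t)) := by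
  set φ := B.chart i with hφ
  set ψ := B.chart i' with hψ
  have hts := B.core_subset i ht
  have hts' := B.core_subset i' ht'
  have hψt : ψ.symm (ψ t) = t := ψ.left_inv hts'
  have hT : ContDiffAt ℝ ∞ (φ ∘ ψ.symm) (ψ t) := by
    have h1 : ContMDiffAt (𝓡 d) (𝓡 d) ∞ φ (ψ.symm (ψ t)) := by
      rw [hψt]
      exact contMDiffAt_of_mem_maximalAtlas (B.chart_mem i) hts
    exact (h1.comp (ψ t) (B.contMDiffAt_symm i' (ψ.map_source hts'))).contDiffAt
  have hTk : ContDiffAt ℝ k (φ ∘ ψ.symm) (ψ t) := hT.of_le (natCast_le_infty k)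
  have hTt : (φ ∘ ψ.symm) (ψ t) = φ t := by simp [hψt]
  set R := 1 + ∑ j ∈ Finset.Iic k, ‖iteratedFDeriv ℝ j (φ ∘ ψ.symm) (ψ t)‖ with hR
  have hR1 : 1 ≤ R := by
    have : 0 ≤ ∑ j ∈ Finset.Iic k, ‖iteratedFDeriv ℝ j (φ ∘ ψ.symm) (ψ t)‖ :=
      Finset.sum_nonneg fun _ _ => norm_nonneg _
    linarith
  have hTR : ∀ l ≤ k, ‖iteratedFDeriv ℝ l (φ ∘ ψ.symm) (ψ t)‖ ≤ R := by
    intro l hl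
    have := Finset.single_le_sum (f := fun j => ‖iteratedFDeriv ℝ j (φ ∘ ψ.symm) (ψ t)‖)
      (fun _ _ => norm_nonneg _) (Finset.mem_Iic.2 hl)
    linarith
  set a : ℕ → ℝ := fun n => ∑ l ∈ Finset.Iic k, ‖chartDeriv φ l (G n) t - chartDeriv φ l g t‖
    with ha
  have ha0 : Tendsto a atTop (𝓝 0) := by
    have : Tendsto a atTop (𝓝 (∑ l ∈ Finset.Iic k, (0 : ℝ))) :=
      tendsto_finsetSum _ fun l hl => by
        have := (h l (Finset.mem_Iic.1 hl)).sub_const (chartDeriv φ l g t)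
        rw [sub_self] at this
        simpa using this.norm
    simpa using this
  rw [tendsto_iff_norm_sub_tendsto_zero]
  have hlim : Tendsto (fun n => compConst k * (a n * R ^ k)) atTop (𝓝 0) := by
    simpa using (ha0.mul_const (R ^ k)).const_mul (compConst k)
  refine squeeze_zero (fun _ => norm_nonneg _) (fun n => ?_) hlim
  rw [← chartDeriv_sub i' hj (hG n) hg ht', chartDeriv]
  have hloc : (fun s => G n s - g s) ∘ ψ.symm =ᶠ[𝓝 (ψ t)]
      ((fun s => G n s - g s) ∘ φ.symm) ∘ (φ ∘ ψ.symm) := by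
    have h1 : ∀ᶠ y in 𝓝 (ψ t), ψ.symm y ∈ φ.source := by
      refine (ψ.continuousAt_symm (ψ.map_source hts')).eventually ?_
      rw [hψt]
      exact φ.open_source.mem_nhds hts
    filter_upwards [h1] with y hy
    simp [φ.left_inv hy]
  rw [(hloc.iteratedFDeriv ℝ j).eq_of_nhds]
  refine norm_iteratedFDeriv_comp_le_compConst hj ?_ hTk hR1 (fun l hl => ?_) hTR
  · rw [hTt]
    exact B.contDiffAt_comp_symm i (natCast_le_infty k) ((hG n).sub hg) (φ.map_source hts)
  · rw [hTt]
    have h1 := chartDeriv_sub i hl (hG n) hg ht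
    rw [chartDeriv] at h1
    rw [h1]
    exact Finset.single_le_sum (f := fun l => ‖chartDeriv φ l (G n) t - chartDeriv φ l g t‖)
      (fun _ _ => norm_nonneg _) (Finset.mem_Iic.2 hl)

/-- Hölder spaces are complete. -/
theorem exists_limit_of_holderBound {G : ℕ → M → EuclideanSpace ℝ (Fin m)} {b : ℕ → ℝ}
    (hb : Tendsto b atTop (𝓝 0)) (hG : ∀ n, ContMDiff (𝓡 d) (𝓡 m) k (G n))
    (hGb : ∀ n l, n ≤ l → HolderBound B k α (fun t => G l t - G n t) (b n)) :
    ∃ g : M → EuclideanSpace ℝ (Fin m), ContMDiff (𝓡 d) (𝓡 m) k g ∧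
      ∀ n, HolderBound B k α (fun t => g t - G n t) (b n) := by
  have hcau : ∀ t, ∃ l, Tendsto (fun n => G n t) atTop (𝓝 l) := by
    intro t
    refine cauchySeq_tendsto_of_complete (cauchySeq_of_le_tendsto_0' b (fun n l h => ?_) hb)
    rw [dist_comm, dist_eq_norm]
    exact (hGb n l h).norm_apply_le t
  choose g hg using hcau
  have hloc : ∀ i, ContDiffOn ℝ k (g ∘ (B.chart i).symm)
        ((B.chart i).target ∩ (B.chart i).symm ⁻¹' interior (B.core i)) ∧
      ∀ j ≤ k, ∀ y ∈ (B.chart i).target ∩ (B.chart i).symm ⁻¹' interior (B.core i),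
        Tendsto (fun n => iteratedFDeriv ℝ j (G n ∘ (B.chart i).symm) y) atTop
          (𝓝 (iteratedFDeriv ℝ j (g ∘ (B.chart i).symm) y)) := by
    intro i
    refine contDiffOn_of_tendsto_of_iteratedFDeriv_sub_le
      ((B.chart i).isOpen_inter_preimage_symm isOpen_interior) hb
      (fun n y hy => B.contDiffAt_comp_symm i (natCast_le_infty k) (hG n) hy.1)
      (fun n l hnl j hj y hy => ?_) (fun y _ => hg _)
    have h1 := (hGb n l hnl).norm_le i j hj _ (interior_subset hy.2)
    rwa [chartDeriv_sub i hj (hG l) (hG n) (interior_subset hy.2), chartDeriv, chartDeriv,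
      (B.chart i).right_inv hy.1] at h1
  have hmem : ∀ i, ∀ t ∈ interior (B.core i), B.chart i t ∈
      (B.chart i).target ∩ (B.chart i).symm ⁻¹' interior (B.core i) := by
    intro i t ht
    have hts := B.core_subset i (interior_subset ht)
    refine ⟨(B.chart i).map_source hts, ?_⟩
    rwa [mem_preimage, (B.chart i).left_inv hts]
  have hgk : ContMDiff (𝓡 d) (𝓡 m) k g := by
    intro t
    obtain ⟨i, hi⟩ := B.exists_mem_interior_core t
    have hts := B.core_subset i (interior_subset hi)
    have h1 : ContDiffAt ℝ k (g ∘ (B.chart i).symm) (B.chart i t) :=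
      (hloc i).1.contDiffAt (((B.chart i).isOpen_inter_preimage_symm
        isOpen_interior).mem_nhds (hmem i t hi))
    have h2 := h1.contMDiffAt.comp t ((contMDiffAt_of_mem_maximalAtlas (B.chart_mem i) hts).of_le
      (natCast_le_infty k))
    refine h2.congr_of_eventuallyEq ?_
    filter_upwards [(B.chart i).open_source.mem_nhds hts] with s hs
    simp [(B.chart i).left_inv hs]
  have htend : ∀ i, ∀ j ≤ k, ∀ t ∈ B.core i, Tendsto (fun n => chartDeriv (B.chart i) j (G n) t)
      atTop (𝓝 (chartDeriv (B.chart i) j g t)) := by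
    intro i j hj t ht
    -- Convergence of derivatives is known only in the interiors of the cores. A boundary point of
    -- one core is interior to another, and a change of charts transfers the convergence.
    obtain ⟨i', hi'⟩ := B.exists_mem_interior_core t
    exact tendsto_chartDeriv_of_tendsto hG hgk (interior_subset hi') ht
      (fun l hl => (hloc i').2 l hl _ (hmem i' t hi')) hj
  refine ⟨g, hgk, fun n => ⟨fun i j hj t ht => ?_, fun i t ht t' ht' => ?_⟩⟩
  · rw [chartDeriv_sub i hj hgk (hG n) ht]
    refine le_of_tendsto ((htend i j hj t ht).sub_const _).norm ?_
    filter_upwards [eventually_ge_atTop n] with l hl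
    rw [← chartDeriv_sub i hj (hG l) (hG n) ht]
    exact (hGb n l hl).norm_le i j hj t ht
  · rw [chartDeriv_sub i le_rfl hgk (hG n) ht, chartDeriv_sub i le_rfl hgk (hG n) ht']
    refine le_of_tendsto (((htend i k le_rfl t ht).sub_const _).sub
      ((htend i k le_rfl t' ht').sub_const _)).norm ?_
    filter_upwards [eventually_ge_atTop n] with l hl
    rw [← chartDeriv_sub i le_rfl (hG l) (hG n) ht, ← chartDeriv_sub i le_rfl (hG l) (hG n) ht']
    exact (hGb n l hl).sub_le i t ht t' ht'

/-- A `C^k` map into the ambient space with values in the embedded manifold is a `C^k` map into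
the manifold. -/
theorem Background.exists_contMDiff_emb_comp [CompactSpace M] (B : Background d M)
    {G : M → EuclideanSpace ℝ (Fin B.dim)} (hG : ContMDiff (𝓡 d) (𝓡 B.dim) k G)
    (hr : ∀ t, G t ∈ range B.emb) :
    ∃ h : M → M, ContMDiff (𝓡 d) (𝓡 d) k h ∧ ∀ t, B.emb (h t) = G t := by
  choose h hh using hr
  have hcont : Continuous h := by
    rw [B.isClosedEmbedding.isEmbedding.continuous_iff]
    convert hG.continuous using 1
    exact funext hh
  refine ⟨h, fun t => ?_, hh⟩
  obtain ⟨r, hr, C, i, e, Ω, he⟩ := B.exists_isLocalRetraction_at (Nat.succ_ne_zero k) (h t)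
  have hGt : G t ∈ Metric.ball (B.emb (h t)) r := by
    rw [← hh t]
    exact Metric.mem_ball_self hr
  have h1 : ContMDiffAt (𝓡 d) (𝓡 d) k (e ∘ G) t :=
    ((he.contDiffAt _ hGt).of_le
      (by exact_mod_cast Nat.le_succ k : (k : WithTop ℕ∞) ≤ (k + 1 : ℕ))).contMDiffAt.comp t (hG t)
  have h2 : ContMDiffAt (𝓡 d) (𝓡 d) k ((B.chart i).symm ∘ (e ∘ G)) t :=
    ((B.contMDiffAt_symm i (he.subset_target (he.mapsTo _ hGt))).of_le
      (natCast_le_infty k)).comp t h1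
  refine h2.congr_of_eventuallyEq ?_
  filter_upwards [hG.continuous.continuousAt (Metric.isOpen_ball.mem_nhds hGt)] with s hs
  have hs' : B.emb (h s) ∈ Metric.ball (B.emb (h t)) r := by
    rw [hh s]
    exact hs
  have := he.left_inv _ hs'
  rw [hh s] at this
  exact this.symm

/-- The estimate behind the convergence to the holonomies. -/
theorem Background.exists_holderBound_comp_comp_sub [CompactSpace M] (B : Background d M)
    (hk : 1 ≤ k) (hα : 0 ≤ α) (hαγ : α ≤ γ) (hγ1 : γ ≤ 1) :
    ∃ C ≥ 1, ∃ N : ℕ, N ≠ 0 ∧ ∀ (h a b g : M → M) (R D : ℝ),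
      ContMDiff (𝓡 d) (𝓡 d) k h → ContMDiff (𝓡 d) (𝓡 d) k a → ContMDiff (𝓡 d) (𝓡 d) k b →
      ContMDiff (𝓡 d) (𝓡 d) k g → 1 ≤ R → 0 ≤ D →
      HolderBound B k γ (fun t => B.emb (h t)) R → HolderBound B k γ (fun t => B.emb (a t)) R →
      HolderBound B k γ (fun t => B.emb (b t)) R → HolderBound B k γ (fun t => B.emb (g t)) R →
      HolderBound B k γ (fun t => B.emb (a t) - B.emb (b t)) D →
      HolderBound B k α (fun t => B.emb (h (a (g t))) - B.emb (h (b (g t))))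
        (C * R ^ N * D ^ (γ - α)) := by
  obtain ⟨C₁, hC₁, h₁⟩ := B.exists_holderBound_comp k B.dim hk (hα.trans hαγ) hγ1
  obtain ⟨C₂, hC₂, h₂⟩ := B.exists_holderBound_comp_sub k B.dim hk hα hαγ hγ1
  have hu : ∀ {g : M → M}, ContMDiff (𝓡 d) (𝓡 d) k g →
      ContMDiff (𝓡 d) (𝓡 B.dim) k (fun t => B.emb (g t)) := fun hg =>
    (B.emb_smooth.of_le (natCast_le_infty k)).comp hg
  -- After composition with `g` the sizes are at most `R' = C₁ * R ^ (k + 2)`, which enters to the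
  -- power `k + 2`; the last `k + 1` comes from composing the difference `a - b` with `g`.
  refine ⟨C₂ * C₁ ^ (k + 2) * C₁, ?_, (k + 2) * (k + 2) + (k + 1), by positivity, ?_⟩
  · exact one_le_mul_of_one_le_of_one_le
      (one_le_mul_of_one_le_of_one_le hC₂ (one_le_pow₀ hC₁)) hC₁
  intro h a b g R D hh ha hb hg hR hD hhR haR hbR hgR hab
  set R' := C₁ * R ^ (k + 2) with hR'
  have hRR' : R ≤ R' := by
    have h1 : R ≤ R ^ (k + 2) := le_self_pow₀ hR (by omega)
    exact h1.trans (le_mul_of_one_le_left (by positivity) hC₁)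
  have e1 : C₁ * (R * R ^ (k + 1)) = R' := by rw [hR']; ring
  have hag := h₁ _ g R R (hu ha) hg hR haR hgR
  have hbg := h₁ _ g R R (hu hb) hg hR hbR hgR
  -- Right composition is linear in the ambient space, so its bound applies to the difference itself
  -- and is linear in `D`.
  have hd := h₁ _ g D R ((hu ha).sub (hu hb)) hg hR hab hgR
  rw [e1] at hag hbg
  refine (h₂ (fun t => B.emb (h t)) (a ∘ g) (b ∘ g) R' _ (hu hh) (ha.comp hg) (hb.comp hg)
    (hR.trans hRR') (hhR.mono hRR') hag hbg hd).mono ?_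
  have e2 : C₁ * (D * R ^ (k + 1)) = (C₁ * R ^ (k + 1)) * D := by ring
  have h3 : (C₁ * R ^ (k + 1) * D) ^ (γ - α) ≤ C₁ * R ^ (k + 1) * D ^ (γ - α) :=
    Real.mul_rpow_le_mul_rpow (one_le_mul_of_one_le_of_one_le hC₁ (one_le_pow₀ hR)) hD
      (by linarith)
  rw [e2]
  calc C₂ * R' ^ (k + 2) * (C₁ * R ^ (k + 1) * D) ^ (γ - α)
      ≤ C₂ * R' ^ (k + 2) * (C₁ * R ^ (k + 1) * D ^ (γ - α)) := by gcongr
    _ = C₂ * C₁ ^ (k + 2) * C₁ * R ^ ((k + 2) * (k + 2) + (k + 1)) * D ^ (γ - α) := by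
      rw [hR', mul_pow, ← pow_mul, pow_add R]
      ring

end Background

end DiffCocycle

namespace DiffCocycle

/-! ### Stable holonomies of dominated cocycles -/

section StableSet

universe u

variable {X : Type u} [MetricSpace X] {f : X ≃ₜ X}

theorem mem_stableSet_self (x : X) : x ∈ stableSet f x :=
  ⟨0, 1 / 2, by norm_num, by norm_num, fun n => by simp⟩

theorem mem_stableSet_comm {x y : X} (h : y ∈ stableSet f x) : x ∈ stableSet f y := by
  obtain ⟨C, τ, h0, h1, h⟩ := h
  exact ⟨C, τ, h0, h1, fun n => by rw [dist_comm]; exact h n⟩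

theorem mem_stableSet_trans {x y z : X} (h : y ∈ stableSet f x) (h' : z ∈ stableSet f y) :
    z ∈ stableSet f x := by
  obtain ⟨C, τ, h0, h1, h⟩ := h
  obtain ⟨C', τ', h0', h1', h'⟩ := h'
  have hC : 0 ≤ C := by simpa using dist_nonneg.trans (h 0)
  have hC' : 0 ≤ C' := by simpa using dist_nonneg.trans (h' 0)
  refine ⟨C + C', max τ τ', lt_max_of_lt_left h0, max_lt h1 h1', fun n => ?_⟩
  calc dist (f^[n] x) (f^[n] z) ≤ C * τ ^ n + C' * τ' ^ n :=
        (dist_triangle _ _ _).trans (add_le_add (h n) (h' n))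
    _ ≤ C * max τ τ' ^ n + C' * max τ τ' ^ n := by
        gcongr
        · exact le_max_left _ _
        · exact le_max_right _ _
    _ = (C + C') * max τ τ' ^ n := by ring

theorem iterate_mem_stableSet {x y : X} (h : y ∈ stableSet f x) (n : ℕ) :
    f^[n] y ∈ stableSet f (f^[n] x) := by
  obtain ⟨C, τ, h0, h1, h⟩ := h
  refine ⟨C * τ ^ n, τ, h0, h1, fun l => ?_⟩
  rw [← Function.iterate_add_apply, ← Function.iterate_add_apply, mul_assoc, ← pow_add,
    add_comm n l]
  exact h _

theorem localStableSet_subset {lam : ℝ} (h0 : 0 < lam) (h1 : lam < 1) (x : X) :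
    localStableSet f lam x ⊆ stableSet f x := fun y hy =>
  ⟨dist x y, lam, h0, h1, fun n => by rw [mul_comm]; exact hy n⟩

end StableSet

/-! ### Cocycle identities and decay of the increments. -/

section Cocycle

variable {X : Type*} {d : ℕ} {M : Type*} [TopologicalSpace M]
  [ChartedSpace (EuclideanSpace ℝ (Fin d)) M] {B : Background d M} {k : ℕ} {α γ : ℝ}

theorem contMDiff_emb_diffeomorph (B : Background d M) (g : M ≃ₘ^k⟮𝓡 d, 𝓡 d⟯ M) :
    ContMDiff (𝓡 d) (𝓡 B.dim) k (fun t => B.emb (g t)) :=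
  (B.emb_smooth.of_le (natCast_le_infty k)).comp g.contMDiff

theorem cocycle_add_apply (f : X → X) (A : X → M ≃ₘ^k⟮𝓡 d, 𝓡 d⟯ M) (n m : ℕ) (x : X) (t : M) :
    cocycle f A (n + m) x t = cocycle f A m (f^[n] x) (cocycle f A n x t) := by
  induction m with
  | zero => rfl
  | succ m ih =>
    change A (f^[n + m] x) (cocycle f A (n + m) x t) =
      A (f^[m] (f^[n] x)) (cocycle f A m (f^[n] x) (cocycle f A n x t))
    rw [ih, add_comm n m, Function.iterate_add_apply]

theorem cocycle_symm_add_apply (f : X → X) (A : X → M ≃ₘ^k⟮𝓡 d, 𝓡 d⟯ M) (n m : ℕ) (x : X)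
    (t : M) : (cocycle f A (n + m) x).symm t =
      (cocycle f A n x).symm ((cocycle f A m (f^[n] x)).symm t) := by
  refine (cocycle f A (n + m) x).injective ?_
  change cocycle f A (n + m) x ((cocycle f A (n + m) x).symm t) = cocycle f A (n + m) x _
  rw [Diffeomorph.apply_symm_apply, cocycle_add_apply, Diffeomorph.apply_symm_apply,
    Diffeomorph.apply_symm_apply]

theorem preHolonomy_self (f : X → X) (A : X → M ≃ₘ^k⟮𝓡 d, 𝓡 d⟯ M) (n : ℕ) (x : X) (t : M) :
    preHolonomy f A n x x t = t :=
  (cocycle f A n x).symm_apply_apply t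

theorem preHolonomy_comp (f : X → X) (A : X → M ≃ₘ^k⟮𝓡 d, 𝓡 d⟯ M) (n : ℕ) (x y z : X) (t : M) :
    preHolonomy f A n y z (preHolonomy f A n x y t) = preHolonomy f A n x z t := by
  change (cocycle f A n z).symm (cocycle f A n y ((cocycle f A n y).symm (cocycle f A n x t))) = _
  rw [Diffeomorph.apply_symm_apply]
  rfl

theorem preHolonomy_add (f : X → X) (A : X → M ≃ₘ^k⟮𝓡 d, 𝓡 d⟯ M) (n m : ℕ) (x y : X) (t : M) :
    preHolonomy f A (n + m) x y t =
      (cocycle f A n y).symm (preHolonomy f A m (f^[n] x) (f^[n] y) (cocycle f A n x t)) := by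
  change (cocycle f A (n + m) y).symm (cocycle f A (n + m) x t) = _
  rw [cocycle_symm_add_apply, cocycle_add_apply]
  rfl

theorem diffDist_le_of_holderBound {g h : M ≃ₘ^k⟮𝓡 d, 𝓡 d⟯ M} {R : ℝ} (hα : 0 ≤ α) (hR : 0 ≤ R)
    (h₁ : HolderBound B k α (fun t => B.emb (g t) - B.emb (h t)) R)
    (h₂ : HolderBound B k α (fun t => B.emb (g.symm t) - B.emb (h.symm t)) R) :
    diffDist B k α g h ≤ ENNReal.ofReal (4 * R) := by
  refine (add_le_add (holderNorm_le_of_holderBound hα h₁)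
    (holderNorm_le_of_holderBound hα h₂)).trans (le_of_eq ?_)
  rw [← ENNReal.ofReal_add hR hR, ← ENNReal.ofReal_add (by linarith) (by linarith)]
  congr 1
  ring

theorem tendstoUniformly_of_tendsto_diffDist {g : ℕ → M ≃ₘ^k⟮𝓡 d, 𝓡 d⟯ M}
    {h : M ≃ₘ^k⟮𝓡 d, 𝓡 d⟯ M} (hα : 0 ≤ α)
    (hgh : Tendsto (fun n => diffDist B k α (g n) h) atTop (𝓝 0)) :
    TendstoUniformly (fun n t => B.emb (g n t)) (fun t => B.emb (h t)) atTop := by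
  rw [Metric.tendstoUniformly_iff]
  intro ε hε
  filter_upwards [hgh.eventually (gt_mem_nhds (ENNReal.ofReal_pos.2 (half_pos hε)))] with n hn t
  have h1 := holderBound_of_holderNorm_le hα (half_pos hε).le (le_self_add.trans hn.le)
  rw [dist_comm, dist_eq_norm]
  exact (h1.norm_apply_le t).trans_lt (half_lt_self hε)

/-- The differences of consecutive approximations of the holonomies decay exponentially. -/
theorem exists_holderBound_preHolonomy_succ_sub [MetricSpace X] [CompactSpace M] (B : Background d M)
    (f : X → X) (A : X → M ≃ₘ^k⟮𝓡 d, 𝓡 d⟯ M)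
    (hk : 1 ≤ k) {β c : ℝ} (hα : 0 ≤ α) (hαγ : α < γ) (hγ1 : γ ≤ 1) (hβ : 0 < β) (hc : 0 ≤ c)
    (hA : ∀ x y, HolderBound B k γ (fun t => B.emb (A x t) - B.emb (A y t)) (c * dist x y ^ β))
    (hgrowth : ∀ ε > 0, ∃ K ≥ 1, ∀ (x : X) (n : ℕ),
      HolderBound B k γ (fun t => B.emb (cocycle f A n x t)) (K * Real.exp (ε * n)) ∧
      HolderBound B k γ (fun t => B.emb ((cocycle f A n x).symm t)) (K * Real.exp (ε * n)))
    {τ : ℝ} (hτ0 : 0 < τ) (hτ1 : τ < 1) :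
    ∃ C ≥ 0, ∃ θ > 0, θ < 1 ∧ ∀ (x y : X) (D : ℝ), 0 ≤ D →
      (∀ n : ℕ, dist (f^[n] x) (f^[n] y) ≤ D * τ ^ n) → ∀ n,
        HolderBound B k α (fun t => B.emb (preHolonomy f A (n + 1) x y t) -
          B.emb (preHolonomy f A n x y t)) (C * D ^ (β * (γ - α)) * θ ^ n) := by
  obtain ⟨C, hC, N, hN, hmain⟩ := B.exists_holderBound_comp_comp_sub hk hα hαγ.le hγ1
  set ρ := γ - α with hρ
  have hρ0 : 0 < ρ := by linarith
  have hlog : Real.log τ < 0 := Real.log_neg hτ0 hτ1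
  have hN0 : (0 : ℝ) < N := by exact_mod_cast Nat.pos_of_ne_zero hN
  -- With this `ε` the growth of `R ^ N` is `τ ^ (-βρn/2)` up to a constant. Against the gain `τ ^
  -- (βρn)` this leaves the ratio `θ = τ ^ (βρ/2) < 1`.
  set ε := -Real.log τ * (β * ρ) / (2 * N) with hε
  have hε0 : 0 < ε := div_pos (mul_pos (neg_pos.2 hlog) (mul_pos hβ hρ0)) (by positivity)
  obtain ⟨K, hK, hgr⟩ := hgrowth ε hε0
  have hεN : ε * N = -Real.log τ * (β * ρ) / 2 := by
    rw [hε]; field_simp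
  refine ⟨C * (K * Real.exp ε) ^ N * c ^ ρ, by positivity, Real.exp (Real.log τ * (β * ρ) / 2),
    Real.exp_pos _, (Real.exp_zero ▸ Real.exp_lt_exp.2 (by
      have := mul_neg_of_neg_of_pos hlog (mul_pos hβ hρ0)
      linarith)), fun x y D hD hxy n => ?_⟩
  set R := K * Real.exp (ε * (n + 1)) with hR
  have hexp : ∀ s : ℝ, s ≤ n + 1 → K * Real.exp (ε * s) ≤ R := fun s hs => by
    rw [hR]; gcongr
  have hR1 : 1 ≤ R :=
    one_le_mul_of_one_le_of_one_le hK (Real.one_le_exp (by positivity))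
  have hAR : ∀ z, HolderBound B k γ (fun t => B.emb (A z t)) R := fun z =>
    (hgr z 1).1.mono (hexp _ (by simp))
  have hdist : c * dist (f^[n] x) (f^[n] y) ^ β ≤ c * (D * τ ^ n) ^ β := by
    gcongr
    exact hxy n
  have hstep := hmain (cocycle f A (n + 1) y).symm (A (f^[n] x)) (A (f^[n] y)) (cocycle f A n x) R
    (c * (D * τ ^ n) ^ β) (cocycle f A (n + 1) y).symm.contMDiff (A _).contMDiff (A _).contMDiff
    (cocycle f A n x).contMDiff hR1 (by positivity)
    ((hgr y (n + 1)).2.mono (hexp _ (by simp))) (hAR _) (hAR _)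
    ((hgr x n).1.mono (hexp _ (by simp))) ((hA _ _).mono hdist)
  have hfun : (fun t => B.emb (preHolonomy f A (n + 1) x y t) - B.emb (preHolonomy f A n x y t)) =
      fun t => B.emb ((cocycle f A (n + 1) y).symm (A (f^[n] x) (cocycle f A n x t))) -
        B.emb ((cocycle f A (n + 1) y).symm (A (f^[n] y) (cocycle f A n x t))) := by
    funext t
    have h1 : (cocycle f A (n + 1) y).symm (A (f^[n] y) (cocycle f A n x t)) =
        preHolonomy f A n x y t := by
      rw [cocycle_symm_add_apply]
      exact congrArg _ ((A (f^[n] y)).symm_apply_apply _)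
    rw [h1]
    rfl
  rw [hfun]
  refine hstep.mono (le_of_eq ?_)
  have e1 : R ^ N = (K * Real.exp ε) ^ N * Real.exp (-Real.log τ * (β * ρ) / 2 * n) := by
    have : R = K * Real.exp ε * Real.exp (ε * n) := by
      rw [hR, mul_assoc, ← Real.exp_add]; ring_nf
    rw [this, mul_pow, ← Real.exp_nat_mul, ← hεN]
    ring_nf
  have e2 : (c * (D * τ ^ n) ^ β) ^ ρ =
      c ^ ρ * D ^ (β * ρ) * Real.exp (Real.log τ * (β * ρ) * n) := by
    rw [Real.mul_rpow hc (by positivity), ← Real.rpow_mul (by positivity),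
      Real.mul_rpow hD (by positivity), ← Real.rpow_natCast, ← Real.rpow_mul hτ0.le,
      Real.rpow_def_of_pos hτ0]
    ring_nf
  have e3 : Real.exp (-Real.log τ * (β * ρ) / 2 * n) * Real.exp (Real.log τ * (β * ρ) * n) =
      Real.exp (Real.log τ * (β * ρ) / 2) ^ n := by
    rw [← Real.exp_add, ← Real.exp_nat_mul]
    ring_nf
  rw [e1, e2, ← e3]
  ring

end Cocycle

end DiffCocycle

/-! ### Existence and uniqueness of the limits. -/

namespace DiffCocycle

section Holonomy

variable {X : Type*} {d : ℕ} {M : Type*} [TopologicalSpace M]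
  [ChartedSpace (EuclideanSpace ℝ (Fin d)) M] {B : Background d M} {k : ℕ} {α γ : ℝ}

/-- The exact partial sum of the geometric series is kept, so that the induction step closes with
equality. -/
theorem holderBound_sub_of_geometric {m : ℕ} {G : ℕ → M → EuclideanSpace ℝ (Fin m)} {C θ : ℝ}
    (hθ1 : θ < 1) (hG : ∀ n, ContMDiff (𝓡 d) (𝓡 m) k (G n))
    (h : ∀ n, HolderBound B k α (fun t => G (n + 1) t - G n t) (C * θ ^ n)) (n l : ℕ) :
    HolderBound B k α (fun t => G (n + l) t - G n t)
      (C * (θ ^ n - θ ^ (n + l)) / (1 - θ)) := by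
  have h1 : 1 - θ ≠ 0 := by linarith
  induction l with
  | zero => simpa using holderBound_sub_self (α := α) (B := B) (hG n)
  | succ l ih =>
    refine ((h (n + l)).sub_add_sub ih (hG _) (hG _) (hG _)).mono (le_of_eq ?_)
    field_simp
    ring

theorem tendstoUniformly_of_holderBound {m : ℕ} {G : ℕ → M → EuclideanSpace ℝ (Fin m)}
    {g : M → EuclideanSpace ℝ (Fin m)} {b : ℕ → ℝ} (hb : Tendsto b atTop (𝓝 0))
    (h : ∀ n, HolderBound B k α (fun t => g t - G n t) (b n)) :
    TendstoUniformly G g atTop := by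
  rw [Metric.tendstoUniformly_iff]
  intro ε hε
  filter_upwards [hb.eventually (gt_mem_nhds hε)] with n hn t
  rw [dist_eq_norm]
  exact ((h n).norm_apply_le t).trans_lt hn

variable [CompactSpace M]

theorem tendsto_of_tendstoUniformly_emb {G : ℕ → M → M} {g : M → M}
    (h : TendstoUniformly (fun n t => B.emb (G n t)) (fun t => B.emb (g t)) atTop) (t : M) :
    Tendsto (fun n => G n t) atTop (𝓝 (g t)) :=
  B.isClosedEmbedding.isEmbedding.tendsto_nhds_iff.2 (h.tendsto_at t)

/-- The outer maps are evaluated at moving points, so their convergence has to be uniform and their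
limit continuous. -/
theorem tendsto_comp_of_tendstoUniformly_emb {G G' : ℕ → M → M} {g g' : M → M}
    (h : TendstoUniformly (fun n t => B.emb (G n t)) (fun t => B.emb (g t)) atTop)
    (h' : TendstoUniformly (fun n t => B.emb (G' n t)) (fun t => B.emb (g' t)) atTop)
    (hg' : Continuous g') (t : M) :
    Tendsto (fun n => G' n (G n t)) atTop (𝓝 (g' (g t))) :=
  B.isClosedEmbedding.isEmbedding.tendsto_nhds_iff.2
    (h'.tendsto_comp (B.emb_smooth.continuous.comp hg').continuousAt
      (tendsto_of_tendstoUniformly_emb h t))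

/-- The limit is taken in the ambient space; it lands in the embedded manifold because the image of
`emb` is closed. -/
theorem exists_contMDiff_limit {G : ℕ → M ≃ₘ^k⟮𝓡 d, 𝓡 d⟯ M} {b : ℕ → ℝ}
    (hb : Tendsto b atTop (𝓝 0))
    (hG : ∀ n l, n ≤ l → HolderBound B k α (fun t => B.emb (G l t) - B.emb (G n t)) (b n)) :
    ∃ g : M → M, ContMDiff (𝓡 d) (𝓡 d) k g ∧
      ∀ n, HolderBound B k α (fun t => B.emb (g t) - B.emb (G n t)) (b n) := by
  obtain ⟨g, hg, hgb⟩ := exists_limit_of_holderBound hb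
    (fun n => contMDiff_emb_diffeomorph B (G n)) hG
  have hr : ∀ t, g t ∈ range B.emb := fun t =>
    B.isClosedEmbedding.isClosed_range.mem_of_tendsto
      ((tendstoUniformly_of_holderBound hb hgb).tendsto_at t)
      (Eventually.of_forall fun n => mem_range_self _)
  obtain ⟨h, hh, hhg⟩ := B.exists_contMDiff_emb_comp hg hr
  refine ⟨h, hh, fun n => ?_⟩
  simp only [hhg]
  exact hgb n

variable [T2Space M]

/-- The holonomies exist, with estimates. -/
theorem exists_holonomy [MetricSpace X] (B : Background d M)
    (f : X → X) (A : X → M ≃ₘ^k⟮𝓡 d, 𝓡 d⟯ M)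
    (hk : 1 ≤ k) {β c : ℝ} (hα : 0 ≤ α) (hαγ : α < γ) (hγ1 : γ ≤ 1) (hβ : 0 < β) (hc : 0 ≤ c)
    (hA : ∀ x y, HolderBound B k γ (fun t => B.emb (A x t) - B.emb (A y t)) (c * dist x y ^ β))
    (hgrowth : ∀ ε > 0, ∃ K ≥ 1, ∀ (x : X) (n : ℕ),
      HolderBound B k γ (fun t => B.emb (cocycle f A n x t)) (K * Real.exp (ε * n)) ∧
      HolderBound B k γ (fun t => B.emb ((cocycle f A n x).symm t)) (K * Real.exp (ε * n)))
    {τ : ℝ} (hτ0 : 0 < τ) (hτ1 : τ < 1) :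
    ∃ C ≥ 0, ∀ (x y : X) (D : ℝ), 0 ≤ D →
      (∀ n : ℕ, dist (f^[n] x) (f^[n] y) ≤ D * τ ^ n) →
      (∀ n, diffDist B k α (preHolonomy f A n x y) (Diffeomorph.refl (𝓡 d) M k) ≤
        ENNReal.ofReal (C * D ^ (β * (γ - α)))) ∧
      ∃ g : M ≃ₘ^k⟮𝓡 d, 𝓡 d⟯ M,
        Tendsto (fun n => diffDist B k α (preHolonomy f A n x y) g) atTop (𝓝 0) ∧
        diffDist B k α g (Diffeomorph.refl (𝓡 d) M k) ≤
          ENNReal.ofReal (C * D ^ (β * (γ - α))) ∧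
        ∃ R, HolderBound B k α (fun t => B.emb (g t) - B.emb t) R ∧
          HolderBound B k α (fun t => B.emb (g.symm t) - B.emb t) R := by
  obtain ⟨C, hC, θ, hθ0, hθ1, hstep⟩ := exists_holderBound_preHolonomy_succ_sub B f A hk hα hαγ hγ1
    hβ hc hA hgrowth hτ0 hτ1
  have h1θ : 0 < 1 - θ := by linarith
  refine ⟨4 * (C / (1 - θ)), by positivity, fun x y D hD hxy => ?_⟩
  set E := C * D ^ (β * (γ - α)) with hE
  have hE0 : 0 ≤ E := by positivity
  set b : ℕ → ℝ := fun n => E / (1 - θ) * θ ^ n with hb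
  have hb0 : Tendsto b atTop (𝓝 0) := by
    simpa using (tendsto_pow_atTop_nhds_zero_of_lt_one hθ0.le hθ1).const_mul (E / (1 - θ))
  have hbn : ∀ n, 0 ≤ b n := fun n => by positivity
  have hyx : ∀ n : ℕ, dist (f^[n] y) (f^[n] x) ≤ D * τ ^ n := fun n => by
    rw [dist_comm]; exact hxy n
  have hcau : ∀ x y, (∀ n : ℕ, dist (f^[n] x) (f^[n] y) ≤ D * τ ^ n) → ∀ n l, n ≤ l →
      HolderBound B k α (fun t => B.emb (preHolonomy f A l x y t) -
        B.emb (preHolonomy f A n x y t)) (b n) := by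
    intro x y hxy n l hnl
    obtain ⟨l, rfl⟩ := Nat.exists_eq_add_of_le hnl
    refine (holderBound_sub_of_geometric (G := fun n t => B.emb (preHolonomy f A n x y t)) hθ1
      (fun n => contMDiff_emb_diffeomorph B _) (hstep x y D hD hxy) n l).mono ?_
    simp only [hb]
    rw [div_mul_eq_mul_div]
    gcongr
    have : 0 ≤ θ ^ (n + l) := by positivity
    linarith
  -- The Cauchy bound at index `0` is the distance to the identity, since `H_0 = Id`. The factor `4`
  -- counts sup norm and seminorm, for the map and for its inverse.
  have hfour : 4 * b 0 = 4 * (C / (1 - θ)) * D ^ (β * (γ - α)) := by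
    simp only [hb, hE]; ring
  refine ⟨fun n => ?_, ?_⟩
  · rw [← hfour]
    exact diffDist_le_of_holderBound hα (hbn 0) (hcau x y hxy 0 n (Nat.zero_le _))
      (hcau y x hyx 0 n (Nat.zero_le _))
  · obtain ⟨g, hg, hgb⟩ := exists_contMDiff_limit hb0 (hcau x y hxy)
    obtain ⟨g', hg', hgb'⟩ := exists_contMDiff_limit hb0 (hcau y x hyx)
    have hu := tendstoUniformly_of_holderBound hb0 hgb
    have hu' := tendstoUniformly_of_holderBound hb0 hgb'
    -- The inverse of the approximation for `(x, y)` is the one for `(y, x)`, so the inverse of the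
    -- limit is itself obtained as a limit.
    have hinv : ∀ t, g' (g t) = t := fun t => by
      have h1 := tendsto_comp_of_tendstoUniformly_emb hu hu' hg'.continuous t
      simp only [preHolonomy_comp, preHolonomy_self] at h1
      exact tendsto_nhds_unique h1 tendsto_const_nhds
    have hinv' : ∀ t, g (g' t) = t := fun t => by
      have h1 := tendsto_comp_of_tendstoUniformly_emb hu' hu hg.continuous t
      simp only [preHolonomy_comp, preHolonomy_self] at h1
      exact tendsto_nhds_unique h1 tendsto_const_nhds
    let G : M ≃ₘ^k⟮𝓡 d, 𝓡 d⟯ M := ⟨⟨g, g', hinv, hinv'⟩, hg, hg'⟩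
    have hGc : ContMDiff (𝓡 d) (𝓡 B.dim) k (fun t => B.emb (g t)) :=
      contMDiff_emb_diffeomorph B G
    have hGc' : ContMDiff (𝓡 d) (𝓡 B.dim) k (fun t => B.emb (g' t)) :=
      contMDiff_emb_diffeomorph B G.symm
    refine ⟨G, ?_, ?_, b 0, hgb 0, hgb' 0⟩
    · have hlim : Tendsto (fun n => ENNReal.ofReal (4 * b n)) atTop (𝓝 0) := by
        simpa using ENNReal.tendsto_ofReal (hb0.const_mul 4)
      refine tendsto_of_tendsto_of_tendsto_of_le_of_le tendsto_const_nhds hlim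
        (fun _ => zero_le) fun n => ?_
      exact diffDist_le_of_holderBound hα (hbn n)
        ((hgb n).sub_comm hGc (contMDiff_emb_diffeomorph B _))
        ((hgb' n).sub_comm hGc' (contMDiff_emb_diffeomorph B _))
    · rw [← hfour]
      exact diffDist_le_of_holderBound hα (hbn 0) (hgb 0) (hgb' 0)

theorem eq_of_tendsto_diffDist {G : ℕ → M ≃ₘ^k⟮𝓡 d, 𝓡 d⟯ M} {g h : M ≃ₘ^k⟮𝓡 d, 𝓡 d⟯ M}
    (hα : 0 ≤ α) (hg : Tendsto (fun n => diffDist B k α (G n) g) atTop (𝓝 0))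
    (hh : Tendsto (fun n => diffDist B k α (G n) h) atTop (𝓝 0)) : g = h :=
  Diffeomorph.ext fun t => tendsto_nhds_unique
    (tendsto_of_tendstoUniformly_emb (tendstoUniformly_of_tendsto_diffDist hα hg) t)
    (tendsto_of_tendstoUniformly_emb (tendstoUniformly_of_tendsto_diffDist hα hh) t)

end Holonomy

end DiffCocycle

end

/-! ### Assembly of the holonomy properties. -/

open DiffCocycle in
theorem proposition3p3
    {X : Type*} [MetricSpace X] [CompactSpace X] (f : X ≃ₜ X) (lam : ℝ)
    (hf : DiffCocycle.IsHyperbolicSystem f lam)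
    {d : ℕ} {M : Type*} [TopologicalSpace M] [T2Space M] [CompactSpace M] [ConnectedSpace M]
    [ChartedSpace (EuclideanSpace ℝ (Fin d)) M] [IsManifold (𝓡 d) ∞ M]
    (B : DiffCocycle.Background d M)
    (k : ℕ) (hk : 1 ≤ k) (α γ β : ℝ) (hα : 0 < α) (hαγ : α < γ) (hγ : γ < 1)
    (hβ : 0 < β) (hβ1 : β ≤ 1)
    (A : X → M ≃ₘ^k⟮𝓡 d, 𝓡 d⟯ M)
    (hA : ∀ x, DiffCocycle.IsDiff B k γ (A x))
    (hHolder : ∃ c : ℝ, 0 < c ∧ ∀ x y : X,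
      DiffCocycle.diffDist B k γ (A x) (A y) ≤ ENNReal.ofReal (c * dist x y ^ β))
    (hgrowth : ∀ ε : ℝ, 0 < ε → ∃ K : ℝ, ∀ (x : X) (n : ℕ),
      DiffCocycle.diffSize B k γ (DiffCocycle.cocycle f A n x) ≤
        ENNReal.ofReal (K * Real.exp (ε * n))) :
    ∃ H : X → X → (M ≃ₘ^k⟮𝓡 d, 𝓡 d⟯ M),
      (∀ x, ∀ y ∈ DiffCocycle.stableSet f x,
        DiffCocycle.IsDiff B k α (H x y) ∧
        Tendsto (fun n : ℕ =>
          DiffCocycle.diffDist B k α (DiffCocycle.preHolonomy f A n x y) (H x y))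
          atTop (𝓝 0)) ∧
      (∀ x, H x x = Diffeomorph.refl (𝓡 d) M k) ∧
      (∀ x, ∀ y ∈ DiffCocycle.stableSet f x, ∀ z ∈ DiffCocycle.stableSet f x,
        (H x y).trans (H y z) = H x z) ∧
      (∀ x, ∀ y ∈ DiffCocycle.stableSet f x, (H x y).symm = H y x) ∧
      (∀ x, ∀ y ∈ DiffCocycle.stableSet f x, ∀ n : ℕ,
        H x y = ((DiffCocycle.cocycle f A n x).trans (H (f^[n] x) (f^[n] y))).trans
          (DiffCocycle.cocycle f A n y).symm) ∧
      (∃ c : ℝ, ∀ x, ∀ y ∈ DiffCocycle.localStableSet f lam x,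
        DiffCocycle.diffDist B k α (H x y) (Diffeomorph.refl (𝓡 d) M k) ≤
          ENNReal.ofReal (c * dist x y ^ (β * (γ - α))) ∧
        ∀ n : ℕ, DiffCocycle.diffDist B k α (DiffCocycle.preHolonomy f A n x y)
            (Diffeomorph.refl (𝓡 d) M k) ≤
          ENNReal.ofReal (c * dist x y ^ (β * (γ - α)))) := by

  obtain ⟨hlam0, hlam1, -⟩ := hf
  obtain ⟨c, hc, hHolder⟩ := hHolder
  have hγ0 : 0 ≤ γ := hα.le.trans hαγ.le
  have hA' : ∀ x y, HolderBound B k γ (fun t => B.emb (A x t) - B.emb (A y t))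
      (c * dist x y ^ β) := fun x y =>
    holderBound_of_holderNorm_le hγ0 (by positivity) (le_self_add.trans (hHolder x y))
  have hgrowth' : ∀ ε > 0, ∃ K ≥ 1, ∀ (x : X) (n : ℕ),
      HolderBound B k γ (fun t => B.emb (cocycle f A n x t)) (K * Real.exp (ε * n)) ∧
      HolderBound B k γ (fun t => B.emb ((cocycle f A n x).symm t)) (K * Real.exp (ε * n)) := by
    intro ε hε
    obtain ⟨K, hK⟩ := hgrowth ε hε
    refine ⟨max K 1, le_max_right _ _, fun x n => ?_⟩
    have h0 : 0 ≤ max K 1 * Real.exp (ε * n) := by positivity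
    have h1 : diffSize B k γ (cocycle f A n x) ≤
        ENNReal.ofReal (max K 1 * Real.exp (ε * n)) :=
      (hK x n).trans (ENNReal.ofReal_le_ofReal (by gcongr; exact le_max_left _ _))
    exact ⟨holderBound_of_holderNorm_le hγ0 h0 (le_self_add.trans h1),
      holderBound_of_holderNorm_le hγ0 h0 (le_add_self.trans h1)⟩
  -- The constant depends on `τ` but not on the pair of points. Global stable pairs use their own
  -- `τ`; the choice `τ = lam`, `D = dist x y` yields the uniform local estimate.
  have hex := fun {τ : ℝ} (h0 : 0 < τ) (h1 : τ < 1) =>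
    exists_holonomy B f A hk hα.le hαγ hγ.le hβ hc.le hA' hgrowth' h0 h1
  have hlimex : ∀ x y, ∃ g : M ≃ₘ^k⟮𝓡 d, 𝓡 d⟯ M, y ∈ stableSet f x →
      Tendsto (fun n => diffDist B k α (preHolonomy f A n x y) g) atTop (𝓝 0) := by
    intro x y
    by_cases hxy : y ∈ stableSet f x
    · obtain ⟨D, τ, h0, h1, hD⟩ := hxy
      obtain ⟨C, -, h⟩ := hex h0 h1
      obtain ⟨-, g, hg, -⟩ := h x y D (by simpa using dist_nonneg.trans (hD 0)) hD
      exact ⟨g, fun _ => hg⟩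
    -- Off the stable set the value is arbitrary.
    · exact ⟨Diffeomorph.refl (𝓡 d) M k, fun h => absurd h hxy⟩
  choose H hH using hlimex
  have hunif : ∀ x, ∀ y ∈ stableSet f x,
      TendstoUniformly (fun n t => B.emb (preHolonomy f A n x y t)) (fun t => B.emb (H x y t))
        atTop := fun x y hxy => tendstoUniformly_of_tendsto_diffDist hα.le (hH x y hxy)
  have hpt : ∀ x, ∀ y ∈ stableSet f x, ∀ t,
      Tendsto (fun n => preHolonomy f A n x y t) atTop (𝓝 (H x y t)) := fun x y hxy =>
    tendsto_of_tendstoUniformly_emb (hunif x y hxy)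
  have hrefl : ∀ x, H x x = Diffeomorph.refl (𝓡 d) M k := fun x => Diffeomorph.ext fun t => by
    have h1 := hpt x x (mem_stableSet_self x) t
    simp only [preHolonomy_self] at h1
    exact tendsto_nhds_unique h1 tendsto_const_nhds
  have htrans : ∀ x, ∀ y ∈ stableSet f x, ∀ z ∈ stableSet f x,
      (H x y).trans (H y z) = H x z := fun x y hy z hz => Diffeomorph.ext fun t => by
    have hyz : z ∈ stableSet f y := mem_stableSet_trans (mem_stableSet_comm hy) hz
    have h1 := tendsto_comp_of_tendstoUniformly_emb (hunif x y hy) (hunif y z hyz)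
      (H y z).continuous t
    simp only [preHolonomy_comp] at h1
    exact tendsto_nhds_unique h1 (hpt x z hz t)
  refine ⟨H, fun x y hy => ⟨?_, hH x y hy⟩, hrefl, htrans, fun x y hy => ?_, fun x y hy n => ?_, ?_⟩
  · obtain ⟨D, τ, h0, h1, hD⟩ := id hy
    obtain ⟨C, -, h⟩ := hex h0 h1
    obtain ⟨-, g, hg, -, R, hR, hR'⟩ := h x y D (by simpa using dist_nonneg.trans (hD 0)) hD
    obtain ⟨K, -, hK⟩ := hgrowth' 1 one_pos
    rw [eq_of_tendsto_diffDist hα.le (hH x y hy) hg]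
    have hid : ContMDiff (𝓡 d) (𝓡 B.dim) k B.emb := B.emb_smooth.of_le (natCast_le_infty k)
    -- The iterate at time `0` is the identity, so the growth bound there controls `emb` itself.
    have hidR := ((hK x 0).1).of_exponent_le hα.le hαγ.le
    have h2 := hR.of_sub hidR (contMDiff_emb_diffeomorph B g) hid
    have h3 := hR'.of_sub hidR (contMDiff_emb_diffeomorph B g.symm) hid
    exact ENNReal.add_lt_top.2
      ⟨(holderNorm_le_of_holderBound hα.le h2).trans_lt (by simp),
        (holderNorm_le_of_holderBound hα.le h3).trans_lt (by simp)⟩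
  · refine Diffeomorph.ext fun t => (H x y).injective ?_
    change H x y ((H x y).symm t) = H x y (H y x t)
    rw [Diffeomorph.apply_symm_apply]
    have h1 := htrans y x (mem_stableSet_comm hy) y (mem_stableSet_self y)
    rw [hrefl] at h1
    exact (DFunLike.congr_fun h1 t).symm
  · refine Diffeomorph.ext fun t => ?_
    -- The shifted sequence `H_{m+n}` has the same limit and factors through the approximations
    -- based at `f^n x`, `f^n y`.
    have h1 := (hpt x y hy t).comp (tendsto_add_atTop_nat n)
    have h2 := ((cocycle f A n y).symm.continuous.tendsto _).comp
      (hpt _ _ (iterate_mem_stableSet hy n) (cocycle f A n x t))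
    refine tendsto_nhds_unique h1 (h2.congr fun m => ?_)
    rw [Function.comp_apply, Function.comp_apply, add_comm, preHolonomy_add]
  · obtain ⟨C, -, h⟩ := hex hlam0 hlam1
    refine ⟨C, fun x y hy => ?_⟩
    have hD : ∀ n : ℕ, dist (f^[n] x) (f^[n] y) ≤ dist x y * lam ^ n := fun n => by
      rw [mul_comm]; exact hy n
    obtain ⟨h1, g, hg, h2, -⟩ := h x y (dist x y) dist_nonneg hD
    rw [eq_of_tendsto_diffDist hα.le (hH x y (localStableSet_subset hlam0 hlam1 x hy)) hg]
    exact ⟨h2, h1⟩
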